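/- **Pfaffian expression of the skew Schur $Q$-multiple zeta functions.** *Notation.* A strict partition is a finite sequence $\lambda=(\lambda_1>\lambda_2>\cdots>\lambda_r\ge 0)$ of integers (the last part may be $0$); its shifted diagram is $SD(\lambda)=\{(i,j)\in\mathbb Z^2 : 1\le i\le r,\ i\le j\le \lambda_i+i-1\}$. Write $\mu\le\lambda$ if $SD(\mu)\subseteq SD(\lambda)$, and then put $SD(\lambda/\mu)=SD(\lambda)\setminus SD(\mu)$. Let $QSST(\lambda/\mu)$ be the set of fillings $M=(m_{ij})$ of $SD(\lambda/\mu)$ with letters from $1'<1<2'<2<\cdots$ that are weakly increasing along rows and columns, with each $k'$ occurring at most once in each row and each $k$ at most once in each column. Put $|k|=|k'|=k$. For a complex filling $\boldsymbol s=(s_{ij})$ put $M^{\boldsymbol s}=\prod_{(i,j)\in SD(\lambda/\mu)}|m_{ij}|^{s_{ij}}$ and $$\zeta^Q_{\lambda/\mu}(\boldsymbol s)=\sum_{M\in QSST(\lambda/\mu)}\frac1{M^{\boldsymbol s}},\qquad \zeta^{Q,N}_{\lambda/\mu}(\boldsymbol s)=\sum_{M\in QSST(\lambda/\mu),\ |m_{ij}|\le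 N}\frac1{M^{\boldsymbol s}},$$ and $\zeta^Q_\lambda=\zeta^Q_{\lambda/\emptyset}$, $\zeta^{Q,N}_\lambda=\zeta^{Q,N}_{\lambda/\emptyset}$. By convention $\zeta^Q_{(0)}=1$ and $\zeta^Q_{(k)}=0$ for $k<0$ (likewise when truncated). For a $2n\times 2n$ upper triangular matrix $A=(a_{ij})$, $$\mathrm{pf}(A)=\sum_{\pi}\mathrm{sgn}(\pi)\prod_{i=1}^n a_{\pi(2i-1),\pi(2i)},$$ where $\pi$ runs over the permutations of $\{1,\dots,2n\}$ with $\pi(1)<\pi(3)<\cdots<\pi(2n-1)$ and $\pi(2i-1)<\pi(2i)$ for all $i$. **Theorem.** Let $\lambda=(\lambda_1,\dots,\lambda_r)$ and $\mu=(\mu_1,\dots,\mu_s)$ be strict partitions with $\mu\le\lambda$ and $r+s$ even, and let $\boldsymbol s=(s_{ij})$ be complex numbers that are constant along the diagonals of $SD(\lambda)$, that is, $s_{ij}=s_{kl}$ whenever $(i,j),(k,l)\in SD(\lambda)$ and $j-i=l-k$. Put $t_i=i+\lambda_i-1$. Let $M_\lambda=(a_{ij})$ be the $r\times r$ strictly upper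 triangular matrix whose entry $a_{ij}$, for $i<j$, is $\zeta^Q_{(\lambda_i,\lambda_j)}$ evaluated at the filling with first row $s_{ii},\dots,s_{it_i}$ and second row $s_{jj},\dots,s_{jt_j}$. Let $H_{\lambda,\mu}=(b_{ij})$ be the $r\times s$ matrix with $$b_{ij}=\zeta^Q_{(\lambda_i-\mu_{s-j+1})}\bigl(s_{i,\,i+\mu_{s-j+1}},\dots,s_{i\,t_i}\bigr).$$ 1. If all series defining the entries of $M_\lambda$ (above the diagonal) and of $H_{\lambda,\mu}$ converge absolutely, then so does the series $\zeta^Q_{\lambda/\mu}(\boldsymbol s)$, and $$\zeta^Q_{\lambda/\mu}(\boldsymbol s)=\mathrm{pf}\begin{pmatrix}M_\lambda&H_{\lambda,\mu}\\0&0\end{pmatrix}.$$ 2. The assumption in 1 holds in particular if $\mathrm{Re}(s_{ij})\ge1$ for all $(i,j)\in SD(\lambda)$ and $\mathrm{Re}(s_{i t_i})>1$ for all $i$ with $\lambda_i>0$. 3. For every integer $N\ge0$ and without any condition of convergence, the identity in 1 holds with every $\zeta^Q$, on both sides, replaced by the truncated function $\zeta^{Q,N}$. -/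

import Mathlib

noncomputable section

namespace SchurQ

/-- The letters `1' < 1 < 2' < 2 < ⋯`: the pair `(k, true)` is the letter `k`, and `(k, false)` is
the marked letter `k'`. The order is lexicographic, with `false < true`. -/
abbrev Letter : Type := ℕ+ ×ₗ Bool

/-- `|k| = |k'| = k`. -/
def Letter.abs (x : Letter) : ℕ := ((ofLex x).1 : ℕ)

/-- The letter is of the form `k'`. -/
def Letter.IsMarked (x : Letter) : Prop := (ofLex x).2 = false

/-- The shifted diagram of `lam = (lam 0, …, lam (r - 1))`. Rows and columns are numbered from `0`,
so that row `i` consists of the boxes `(i, j)` with `i ≤ j < i + lam i`; the content of the box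
`(i, j)` is `j - i`, as with numbering from `1`. -/
def shiftedDiagram {r : ℕ} (lam : Fin r → ℕ) : Finset (ℕ × ℕ) :=
  Finset.univ.biUnion fun i : Fin r =>
    (Finset.Ico (i : ℕ) (i + lam i)).image fun j => ((i : ℕ), j)

theorem mem_shiftedDiagram {r : ℕ} (lam : Fin r → ℕ) (b : ℕ × ℕ) :
    b ∈ shiftedDiagram lam ↔ ∃ i : Fin r, b.1 = i ∧ b.1 ≤ b.2 ∧ b.2 < b.1 + lam i := by
  obtain ⟨x, y⟩ := b
  simp only [shiftedDiagram, Finset.mem_biUnion, Finset.mem_univ, true_and, Finset.mem_image,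
    Finset.mem_Ico, Prod.mk.injEq]
  constructor
  · rintro ⟨i, j, ⟨h1, h2⟩, rfl, rfl⟩
    exact ⟨i, rfl, h1, h2⟩
  · rintro ⟨i, rfl, h1, h2⟩
    exact ⟨i, y, ⟨h1, h2⟩, rfl, rfl⟩

/-- The skew shifted diagram of `lam/mu` (used for `mu ≤ lam`, that is, when the diagram of `mu` is
contained in that of `lam`). -/
def skewShiftedDiagram {r s : ℕ} (lam : Fin r → ℕ) (mu : Fin s → ℕ) : Finset (ℕ × ℕ) :=
  shiftedDiagram lam \ shiftedDiagram mu

/-- The semistandard marked tableaux on a set `D` of boxes, without a condition on the main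
diagonal: the set `QSST`. -/
structure IsQSST (D : Finset (ℕ × ℕ)) (t : D → Letter) : Prop where
  row_weak : ∀ p q : D, p.1.1 = q.1.1 → p.1.2 ≤ q.1.2 → t p ≤ t q
  col_weak : ∀ p q : D, p.1.2 = q.1.2 → p.1.1 ≤ q.1.1 → t p ≤ t q
  /-- each marked letter occurs at most once in each row -/
  row_marked : ∀ p q : D, p.1.1 = q.1.1 → t p = t q → (t p).IsMarked → p = q
  /-- each unmarked letter occurs at most once in each column -/
  col_unmarked : ∀ p q : D, p.1.2 = q.1.2 → t p = t q → ¬ (t p).IsMarked → p = q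

def QSST (D : Finset (ℕ × ℕ)) : Set (D → Letter) := {t | IsQSST D t}

/-- The tableaux in `QSST D` all of whose entries are at most `N`. -/
def QSSTUpTo (N : ℕ) (D : Finset (ℕ × ℕ)) : Set (D → Letter) :=
  {t | IsQSST D t ∧ ∀ b, (t b).abs ≤ N}

theorem QSSTUpTo_finite (N : ℕ) (D : Finset (ℕ × ℕ)) : (QSSTUpTo N D).Finite := by
  have hL : {x : Letter | x.abs ≤ N}.Finite := by
    refine Set.Finite.of_finite_image (f := fun x : Letter => (x.abs, (ofLex x).2)) ?_ ?_
    · refine ((Set.finite_Iic N).prod (Set.finite_univ (α := Bool))).subset ?_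
      rintro _ ⟨x, hx, rfl⟩
      exact ⟨hx, trivial⟩
    · intro x _ y _ h
      simp only [Letter.abs, Prod.mk.injEq, PNat.coe_inj] at h
      exact ofLex.injective (Prod.ext h.1 h.2)
  refine (Set.Finite.pi' fun _ : D => hL).subset ?_
  intro t ht b
  exact ht.2 b

/-- `1 / M ^ s`, where `M ^ s` is the product of `|m_b| ^ (s_b)` over the boxes `b` of `D`. Only the
values of `s` on `D` matter. -/
def term (D : Finset (ℕ × ℕ)) (s : ℕ × ℕ → ℂ) (t : D → Letter) : ℂ :=
  1 / ∏ b : D, ((t b).abs : ℂ) ^ s b.1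

/-- The series defining the `Q`-multiple zeta function of `D` converges absolutely at `s`. -/
def Converges (D : Finset (ℕ × ℕ)) (s : ℕ × ℕ → ℂ) : Prop :=
  Summable fun t : QSST D => term D s t.1

/-- The Schur `Q`-multiple zeta function of `D`. -/
def zetaQ (D : Finset (ℕ × ℕ)) (s : ℕ × ℕ → ℂ) : ℂ :=
  ∑' t : QSST D, term D s t.1

/-- The truncated Schur `Q`-multiple zeta function of `D`. -/
def zetaQUpTo (N : ℕ) (D : Finset (ℕ × ℕ)) (s : ℕ × ℕ → ℂ) : ℂ :=
  ∑ t ∈ (QSSTUpTo_finite N D).toFinset, term D s t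

/-- `s` is constant on the diagonals of `D`. -/
def DiagonalConstant (D : Finset (ℕ × ℕ)) (s : ℕ × ℕ → ℂ) : Prop :=
  ∀ p ∈ D, ∀ q ∈ D, (p.2 : ℤ) - p.1 = (q.2 : ℤ) - q.1 → s p = s q

/-- The filling of the two-row shifted diagram of `(lam i, lam j)` whose first row is row `i` of `s`
and whose second row is row `j` of `s`, both starting from the main diagonal. -/
def twoRowFilling (s : ℕ × ℕ → ℂ) (i j : ℕ) : ℕ × ℕ → ℂ := fun b =>
  if b.1 = 0 then s (i, i + b.2) else s (j, j + (b.2 - 1))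

/-- The filling of a one-row diagram by the entries `s (i, i + m), s (i, i + m + 1), …`. -/
def oneRowFilling (s : ℕ × ℕ → ℂ) (i m : ℕ) : ℕ × ℕ → ℂ := fun b => s (i, i + m + b.2)

/-- The upper triangular matrix `M_lam`, for `Z` the `Q`-multiple zeta function or its
truncation. -/
def matrixM (Z : Finset (ℕ × ℕ) → (ℕ × ℕ → ℂ) → ℂ) {r : ℕ} (lam : Fin r → ℕ) (s : ℕ × ℕ → ℂ) :
    Matrix (Fin r) (Fin r) ℂ := fun i j =>
  if i < j then Z (shiftedDiagram ![lam i, lam j]) (twoRowFilling s i j) else 0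

/-- The matrix `H_{lam, mu}`: its columns belong to the parts of `mu` in reverse order. A one-row
function of negative length is `0`. -/
def matrixH (Z : Finset (ℕ × ℕ) → (ℕ × ℕ → ℂ) → ℂ) {r m : ℕ} (lam : Fin r → ℕ) (mu : Fin m → ℕ)
    (s : ℕ × ℕ → ℂ) : Matrix (Fin r) (Fin m) ℂ := fun i j =>
  if mu j.rev ≤ lam i then
    Z (shiftedDiagram ![lam i - mu j.rev]) (oneRowFilling s i (mu j.rev)) else 0

/-- The block matrix with blocks `M_lam`, `H_{lam, mu}`, `0`, `0`, with rows and columns numbered by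
`Fin (2 * n)`. -/
def blockMatrix (Z : Finset (ℕ × ℕ) → (ℕ × ℕ → ℂ) → ℂ) {r m n : ℕ} (h : r + m = 2 * n)
    (lam : Fin r → ℕ) (mu : Fin m → ℕ) (s : ℕ × ℕ → ℂ) :
    Matrix (Fin (2 * n)) (Fin (2 * n)) ℂ :=
  Matrix.reindex (finSumFinEquiv.trans (finCongr h)) (finSumFinEquiv.trans (finCongr h))
    (Matrix.fromBlocks (matrixM Z lam s) (matrixH Z lam mu s) 0 0)

/-- The two-row and one-row series that occur in the block matrix converge absolutely at their
arguments. -/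
def EntriesConverge {r m : ℕ} (lam : Fin r → ℕ) (mu : Fin m → ℕ) (s : ℕ × ℕ → ℂ) : Prop :=
  (∀ i j : Fin r, i < j → Converges (shiftedDiagram ![lam i, lam j]) (twoRowFilling s i j)) ∧
  (∀ (i : Fin r) (k : Fin m), mu k ≤ lam i →
    Converges (shiftedDiagram ![lam i - mu k]) (oneRowFilling s i (mu k)))

/-- The first element of the `i`-th pair of `Fin (2 * n)`. -/
def pairFst {n : ℕ} (i : Fin n) : Fin (2 * n) := ⟨2 * i, by omega⟩

/-- The second element of the `i`-th pair of `Fin (2 * n)`. -/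
def pairSnd {n : ℕ} (i : Fin n) : Fin (2 * n) := ⟨2 * i + 1, by omega⟩

/-- The permutations `π` with `π(1) < π(3) < ⋯ < π(2n - 1)` and `π(2i - 1) < π(2i)` for all `i`
(in numbering from `1`). -/
def pfaffianPerms (n : ℕ) : Finset (Equiv.Perm (Fin (2 * n))) :=
  Finset.univ.filter fun π =>
    (∀ i j : Fin n, i < j → π (pairFst i) < π (pairFst j)) ∧
    (∀ i : Fin n, π (pairFst i) < π (pairSnd i))

/-- The pfaffian of an upper triangular (or antisymmetric) matrix. -/
def pfaffian {n : ℕ} (A : Matrix (Fin (2 * n)) (Fin (2 * n)) ℂ) : ℂ :=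
  ∑ π ∈ pfaffianPerms n,
    ((Equiv.Perm.sign π : ℤ) : ℂ) * ∏ i : Fin n, A (π (pairFst i)) (π (pairSnd i))

end SchurQ

end

/-! ### Pfaffians -/

namespace SchurQ

/-! The series identity is the limit of the truncated one, and the truncated one holds because both
sides obey the same recursion with the same initial values.

Let `L` be the largest part of the partition. Replace every letter by `L` consecutive instants, one
for each content `0, …, L - 1`, in decreasing order of contents for a marked letter and in
increasing order for an unmarked one. Contents increase along rows and decrease down columns, so a
filling is semistandard exactly when the resulting times increase strictly along rows and columns
(`isQSST_iff`). Since the exponents depend only on the content, the weight of a tableau is a product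
of weights of its times (`zetaQUpTo_eq_scheduleSum`).

At an instant only one content `k` is allowed, and a strict partition has at most one removable box
of content `k`: the end of the part `k + 1`, provided that `k` is not also a part or that `k = 0`.
Distinguishing whether this box is filled at the last instant `m` gives `F (m + 1) lam = F m lam + x
m * F m lam'`, where `lam'` has the part `k + 1` lowered to `k`; without such a box nothing changes
(`skewSum_succ_of_eq`, `skewSum_succ_of_blocked`, `skewSum_succ_of_forall_ne`).

The matrix entries are the same functions for two-row shapes and for skew rows, so they obey the
same rules. Only one index of the matrix carries the part `k + 1`, and the pfaffian is linear in the
entries involving that index (`pfaffian_add_row`); this yields the same recursion. If `k + 1` and `k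
≠ 0` are both parts, the additional pfaffian has two equal adjacent rows and vanishes
(`pfaffian_eq_zero_of_adjacent`). With no instants available, both sides are `1` for `lam = mu` and
`0` otherwise (`pfaffian_skewMatrix_initial`). Induction on the number of instants gives
`skewSum_eq_pfaffian`.

For absolute convergence, the truncated identity is applied to the real parts of the exponents: the
sums of absolute values then equal pfaffians of convergent entries, hence are bounded. -/

theorem exists_eq_pairFst_or_pairSnd {n : ℕ} (p : Fin (2 * n)) :
    ∃ k : Fin n, p = pairFst k ∨ p = pairSnd k := by
  refine ⟨⟨p / 2, by omega⟩, ?_⟩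
  simp only [pairFst, pairSnd, Fin.ext_iff]
  omega

theorem pairFst_injective {n : ℕ} : Function.Injective (pairFst (n := n)) := by
  intro i j h
  simp only [pairFst, Fin.ext_iff] at h ⊢
  omega

theorem pairSnd_injective {n : ℕ} : Function.Injective (pairSnd (n := n)) := by
  intro i j h
  simp only [pairSnd, Fin.ext_iff] at h ⊢
  omega

theorem pairFst_ne_pairSnd {n : ℕ} (i j : Fin n) : pairFst i ≠ pairSnd j := by
  intro h
  simp only [pairFst, pairSnd, Fin.ext_iff] at h
  omega

theorem mem_pfaffianPerms {n : ℕ} {π : Equiv.Perm (Fin (2 * n))} :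
    π ∈ pfaffianPerms n ↔ (∀ i j : Fin n, i < j → π (pairFst i) < π (pairFst j)) ∧
      ∀ i : Fin n, π (pairFst i) < π (pairSnd i) := by
  simp [pfaffianPerms]

/-- The pfaffian is linear in the entries that involve a given index. -/
theorem pfaffian_add_row {n : ℕ} {A B C : Matrix (Fin (2 * n)) (Fin (2 * n)) ℂ} (i : Fin (2 * n))
    (x : ℂ) (h0 : ∀ u v, u < v → u ≠ i → v ≠ i → A u v = B u v ∧ A u v = C u v)
    (h1 : ∀ u v, u < v → u = i ∨ v = i → A u v = B u v + x * C u v) :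
    pfaffian A = pfaffian B + x * pfaffian C := by
  simp only [pfaffian, Finset.mul_sum]
  rw [← Finset.sum_add_distrib]
  refine Finset.sum_congr rfl fun π hπ => ?_
  rw [mem_pfaffianPerms] at hπ
  obtain ⟨k, hk⟩ := exists_eq_pairFst_or_pairSnd (π.symm i)
  have hk' : π (pairFst k) = i ∨ π (pairSnd k) = i := by
    rcases hk with hk | hk
    · left; rw [← hk]; simp
    · right; rw [← hk]; simp
  have hne : ∀ j, j ≠ k → π (pairFst j) ≠ i ∧ π (pairSnd j) ≠ i := by
    intro j hj
    constructor
    · rintro rfl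
      rw [Equiv.symm_apply_apply] at hk
      rcases hk with hk | hk
      · exact hj (pairFst_injective hk)
      · exact pairFst_ne_pairSnd _ _ hk
    · rintro rfl
      rw [Equiv.symm_apply_apply] at hk
      rcases hk with hk | hk
      · exact pairFst_ne_pairSnd _ _ hk.symm
      · exact hj (pairSnd_injective hk)
  have hB : ∏ j ∈ Finset.univ.erase k, A (π (pairFst j)) (π (pairSnd j)) =
      ∏ j ∈ Finset.univ.erase k, B (π (pairFst j)) (π (pairSnd j)) :=
    Finset.prod_congr rfl fun j hj =>
      (h0 _ _ (hπ.2 j) (hne j (Finset.ne_of_mem_erase hj)).1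
        (hne j (Finset.ne_of_mem_erase hj)).2).1
  have hC : ∏ j ∈ Finset.univ.erase k, A (π (pairFst j)) (π (pairSnd j)) =
      ∏ j ∈ Finset.univ.erase k, C (π (pairFst j)) (π (pairSnd j)) :=
    Finset.prod_congr rfl fun j hj =>
      (h0 _ _ (hπ.2 j) (hne j (Finset.ne_of_mem_erase hj)).1
        (hne j (Finset.ne_of_mem_erase hj)).2).2
  rw [← Finset.mul_prod_erase _ _ (Finset.mem_univ k),
    ← Finset.mul_prod_erase (f := fun j => B (π (pairFst j)) (π (pairSnd j))) _
      (Finset.mem_univ k),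
    ← Finset.mul_prod_erase (f := fun j => C (π (pairFst j)) (π (pairSnd j))) _
      (Finset.mem_univ k), ← hB, ← hC, h1 _ _ (hπ.2 k) hk']
  ring

theorem pfaffian_eq_zero_of_row {n : ℕ} {A : Matrix (Fin (2 * n)) (Fin (2 * n)) ℂ}
    (i : Fin (2 * n)) (h : ∀ u v, u < v → u = i ∨ v = i → A u v = 0) : pfaffian A = 0 := by
  -- Zero entries satisfy `0 = 0 + 1 * 0`, so linearity gives `pfaffian A = pfaffian A + pfaffian
  -- A`.
  have := pfaffian_add_row (A := A) (B := A) (C := A) i 1 (fun _ _ _ _ _ => ⟨rfl, rfl⟩)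
    (fun u v huv hi => by rw [h u v huv hi]; simp)
  simpa using this

theorem pfaffian_congr {n : ℕ} {A B : Matrix (Fin (2 * n)) (Fin (2 * n)) ℂ}
    (h : ∀ u v, u < v → A u v = B u v) : pfaffian A = pfaffian B := by
  refine Finset.sum_congr rfl fun π hπ => ?_
  rw [mem_pfaffianPerms] at hπ
  congr 1
  exact Finset.prod_congr rfl fun j _ => h _ _ (hπ.2 j)

/-- The permutation of `Fin (2 * n + 2)` that sends `0` to `0`, `1` to `q + 1`, and the remaining
elements to the remaining elements in the way prescribed by `σ`. -/
def extendPerm {n : ℕ} (q : Fin (2 * n + 1)) (σ : Equiv.Perm (Fin (2 * n))) :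
    Equiv.Perm (Fin (2 * (n + 1))) :=
  Equiv.Perm.decomposeFin.symm (0, q.cycleRange.symm * Equiv.Perm.decomposeFin.symm (0, σ))

theorem pairFst_zero {n : ℕ} : pairFst (0 : Fin (n + 1)) = (0 : Fin (2 * n + 1 + 1)) := rfl

theorem pairSnd_zero {n : ℕ} :
    pairSnd (0 : Fin (n + 1)) = (Fin.succ 0 : Fin (2 * n + 1 + 1)) := rfl

theorem pairFst_succ {n : ℕ} (k : Fin n) :
    pairFst k.succ = ((pairFst k).succ.succ : Fin (2 * n + 1 + 1)) := rfl

theorem pairSnd_succ {n : ℕ} (k : Fin n) :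
    pairSnd k.succ = ((pairSnd k).succ.succ : Fin (2 * n + 1 + 1)) := rfl

theorem extendPerm_fst_zero {n : ℕ} (q : Fin (2 * n + 1)) (σ : Equiv.Perm (Fin (2 * n))) :
    extendPerm q σ (pairFst 0) = (0 : Fin (2 * n + 1 + 1)) := by
  rw [pairFst_zero]
  exact Equiv.Perm.decomposeFin_symm_apply_zero _ _

theorem extendPerm_succ {n : ℕ} (q : Fin (2 * n + 1)) (σ : Equiv.Perm (Fin (2 * n)))
    (u : Fin (2 * n + 1)) : extendPerm q σ (u.succ : Fin (2 * n + 1 + 1)) =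
      ((q.cycleRange.symm (Equiv.Perm.decomposeFin.symm (0, σ) u)).succ : Fin (2 * n + 1 + 1)) := by
  have := Equiv.Perm.decomposeFin_symm_apply_succ
    (q.cycleRange.symm * Equiv.Perm.decomposeFin.symm (0, σ)) 0 u
  rw [Equiv.swap_self] at this
  exact this

theorem extendPerm_snd_zero {n : ℕ} (q : Fin (2 * n + 1)) (σ : Equiv.Perm (Fin (2 * n))) :
    extendPerm q σ (pairSnd 0) = (q.succ : Fin (2 * n + 1 + 1)) := by
  rw [pairSnd_zero, extendPerm_succ, Equiv.Perm.decomposeFin_symm_apply_zero,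
    Fin.cycleRange_symm_zero]

theorem extendPerm_succ_succ {n : ℕ} (q : Fin (2 * n + 1)) (σ : Equiv.Perm (Fin (2 * n)))
    (u : Fin (2 * n)) : extendPerm q σ (u.succ.succ : Fin (2 * n + 1 + 1)) =
      ((q.succAbove (σ u)).succ : Fin (2 * n + 1 + 1)) := by
  rw [extendPerm_succ, Equiv.Perm.decomposeFin_symm_apply_succ, Equiv.swap_self,
    Equiv.refl_apply, Fin.cycleRange_symm_succ]

theorem extendPerm_mem_iff {n : ℕ} (q : Fin (2 * n + 1)) (σ : Equiv.Perm (Fin (2 * n))) :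
    extendPerm q σ ∈ pfaffianPerms (n + 1) ↔ σ ∈ pfaffianPerms n := by
  simp only [mem_pfaffianPerms]
  have hlt : ∀ u v : Fin (2 * n),
      ((q.succAbove u).succ : Fin (2 * n + 1 + 1)) < (q.succAbove v).succ ↔ u < v := by
    intro u v
    rw [Fin.succ_lt_succ_iff, Fin.succAbove_lt_succAbove_iff]
  constructor
  · rintro ⟨h1, h2⟩
    constructor
    · intro i j hij
      have := h1 i.succ j.succ (Fin.succ_lt_succ_iff.2 hij)
      rw [pairFst_succ, pairFst_succ, extendPerm_succ_succ, extendPerm_succ_succ] at this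
      exact (hlt _ _).1 this
    · intro i
      have := h2 i.succ
      rw [pairFst_succ, pairSnd_succ, extendPerm_succ_succ, extendPerm_succ_succ] at this
      exact (hlt _ _).1 this
  · rintro ⟨h1, h2⟩
    constructor
    · intro i j hij
      induction j using Fin.cases with
      | zero => exact absurd hij (by simp)
      | succ j =>
        induction i using Fin.cases with
        | zero =>
          rw [extendPerm_fst_zero, pairFst_succ, extendPerm_succ_succ]
          exact Fin.succ_pos _
        | succ i =>
          rw [pairFst_succ, pairFst_succ, extendPerm_succ_succ, extendPerm_succ_succ]
          exact (hlt _ _).2 (h1 i j (Fin.succ_lt_succ_iff.1 hij))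
    · intro i
      induction i using Fin.cases with
      | zero =>
        rw [extendPerm_fst_zero, extendPerm_snd_zero]
        exact Fin.succ_pos _
      | succ i =>
        rw [pairFst_succ, pairSnd_succ, extendPerm_succ_succ, extendPerm_succ_succ]
        exact (hlt _ _).2 (h2 i)

theorem apply_pairFst_zero_of_mem {n : ℕ} {π : Equiv.Perm (Fin (2 * (n + 1)))}
    (hπ : π ∈ pfaffianPerms (n + 1)) : π (pairFst 0) = (0 : Fin (2 * n + 1 + 1)) := by
  rw [mem_pfaffianPerms] at hπ
  obtain ⟨k, hk⟩ := exists_eq_pairFst_or_pairSnd (π.symm (0 : Fin (2 * n + 1 + 1)))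
  rcases hk with hk | hk
  · have h0 : π (pairFst k) = (0 : Fin (2 * n + 1 + 1)) := by rw [← hk]; simp
    rcases eq_or_ne k 0 with rfl | h
    · exact h0
    · have := hπ.1 0 k (Fin.pos_of_ne_zero h)
      rw [h0] at this
      exact absurd this (Fin.not_lt_zero _)
  · have h0 : π (pairSnd k) = (0 : Fin (2 * n + 1 + 1)) := by rw [← hk]; simp
    have := hπ.2 k
    rw [h0] at this
    exact absurd this (Fin.not_lt_zero _)

/-- Splitting off the fixed point `0` leaves a permutation sending `0` to `q`. Composed with the
cycle that takes `q` back to `0`, it fixes `0` again, and what remains is `σ`. -/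
theorem exists_extendPerm_eq {n : ℕ} (q : Fin (2 * n + 1)) {π : Equiv.Perm (Fin (2 * (n + 1)))}
    (h0 : π (pairFst 0) = (0 : Fin (2 * n + 1 + 1)))
    (h1 : π (pairSnd 0) = (q.succ : Fin (2 * n + 1 + 1))) : ∃ σ, extendPerm q σ = π := by
  obtain ⟨⟨p, τ⟩, rfl⟩ := (Equiv.Perm.decomposeFin (n := 2 * n + 1)).symm.surjective π
  have hp : p = 0 := by
    rw [← h0]
    exact (Equiv.Perm.decomposeFin_symm_apply_zero _ _).symm
  subst hp
  have hτ : τ 0 = q := by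
    have h2 := Equiv.Perm.decomposeFin_symm_apply_succ τ 0 0
    rw [Equiv.swap_self] at h2
    exact Fin.succ_injective _ (h2.symm.trans h1)
  obtain ⟨⟨p', σ⟩, hσ⟩ := (Equiv.Perm.decomposeFin (n := 2 * n)).symm.surjective
    (q.cycleRange * τ)
  have hp' : p' = 0 := by
    have h3 := Equiv.Perm.decomposeFin_symm_apply_zero p' σ
    rw [hσ, Equiv.Perm.mul_apply, hτ, Fin.cycleRange_self] at h3
    exact h3.symm
  subst hp'
  refine ⟨σ, ?_⟩
  unfold extendPerm
  rw [hσ]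
  congr 2
  ext u
  simp

theorem extendPerm_injective {n : ℕ} (q : Fin (2 * n + 1)) :
    Function.Injective (extendPerm q) := by
  intro σ τ h
  ext u : 1
  have h2 := DFunLike.congr_fun h (u.succ.succ : Fin (2 * n + 1 + 1))
  rw [extendPerm_succ_succ, extendPerm_succ_succ] at h2
  exact Fin.succAbove_right_injective (Fin.succ_injective _ h2)

/-- Added fixed points do not affect the sign; the factor comes from the cycle on `0, …, q`. -/
theorem sign_extendPerm {n : ℕ} (q : Fin (2 * n + 1)) (σ : Equiv.Perm (Fin (2 * n))) :
    Equiv.Perm.sign (extendPerm q σ) = (-1) ^ (q : ℕ) * Equiv.Perm.sign σ := by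
  unfold extendPerm
  refine (Equiv.Perm.decomposeFin.symm_sign _ _).trans ?_
  rw [if_pos rfl, one_mul, Equiv.Perm.sign_mul, Equiv.Perm.sign_symm, Fin.sign_cycleRange,
    Equiv.Perm.decomposeFin.symm_sign, if_pos rfl, one_mul]

/-- Expansion along the first row, when that row has only one nonzero entry. -/
theorem pfaffian_row_single {n : ℕ} (A : Matrix (Fin (2 * (n + 1))) (Fin (2 * (n + 1))) ℂ)
    (q : Fin (2 * n + 1))
    (hA : ∀ j : Fin (2 * n + 1), j ≠ q →
      A (0 : Fin (2 * n + 1 + 1)) (j.succ : Fin (2 * n + 1 + 1)) = 0) :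
    pfaffian A = (-1) ^ (q : ℕ) * A (0 : Fin (2 * n + 1 + 1)) (q.succ : Fin (2 * n + 1 + 1)) *
      pfaffian (fun u v : Fin (2 * n) => A ((q.succAbove u).succ : Fin (2 * n + 1 + 1))
        ((q.succAbove v).succ : Fin (2 * n + 1 + 1))) := by
  simp only [pfaffian]
  rw [Finset.mul_sum]
  symm
  refine Finset.sum_of_injOn (extendPerm q) (extendPerm_injective q).injOn
    (fun σ hσ => (extendPerm_mem_iff q σ).2 hσ) ?_ ?_
  -- A matching outside the image pairs `0` with an index other than `q + 1`, and the corresponding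
  -- factor is zero.
  · intro π hπ hn
    have h0 := apply_pairFst_zero_of_mem hπ
    have h1 : π (pairSnd 0) ≠ (q.succ : Fin (2 * n + 1 + 1)) := by
      intro h1
      obtain ⟨σ, rfl⟩ := exists_extendPerm_eq q h0 h1
      exact hn ⟨σ, (extendPerm_mem_iff q σ).1 hπ, rfl⟩
    have h2 : A (π (pairFst 0)) (π (pairSnd 0)) = 0 := by
      have h3 : π (pairSnd 0) ≠ (0 : Fin (2 * n + 1 + 1)) := by
        have := (mem_pfaffianPerms.1 hπ).2 0
        rw [h0] at this
        exact this.ne'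
      obtain ⟨j, hj⟩ := Fin.exists_succ_eq.2 h3
      rw [h0, ← hj]
      refine hA j ?_
      rintro rfl
      exact h1 hj.symm
    rw [Finset.prod_eq_zero (Finset.mem_univ 0) h2, mul_zero]
  · intro σ hσ
    rw [Fin.prod_univ_succ, extendPerm_fst_zero, extendPerm_snd_zero, sign_extendPerm]
    simp only [pairFst_succ, pairSnd_succ, extendPerm_succ_succ]
    push_cast
    ring

end SchurQ

/-! ### Vanishing of pfaffians with two equal adjacent rows -/

namespace SchurQ

/-- The number of the pair that contains a given index. -/
def pairIndex {n : ℕ} (p : Fin (2 * n)) : Fin n := ⟨p / 2, by omega⟩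

theorem pairIndex_pairFst {n : ℕ} (k : Fin n) : pairIndex (pairFst k) = k := by
  simp only [pairIndex, pairFst, Fin.ext_iff]; omega

theorem pairIndex_pairSnd {n : ℕ} (k : Fin n) : pairIndex (pairSnd k) = k := by
  simp only [pairIndex, pairSnd, Fin.ext_iff]; omega

theorem eq_pairFst_or_pairSnd_pairIndex {n : ℕ} (p : Fin (2 * n)) :
    p = pairFst (pairIndex p) ∨ p = pairSnd (pairIndex p) := by
  simp only [pairIndex, pairFst, pairSnd, Fin.ext_iff]; omega

open Classical in
/-- An involution on matchings that interchanges the adjacent indices `a` and `b`, unless they are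
matched with each other. -/
def swapAdjacent {n : ℕ} (a b : Fin (2 * n)) (π : Equiv.Perm (Fin (2 * n))) :
    Equiv.Perm (Fin (2 * n)) :=
  if pairIndex (π.symm a) = pairIndex (π.symm b) then π
  else if π.symm a = pairFst (pairIndex (π.symm a)) ∧ π.symm b = pairFst (pairIndex (π.symm b))
  then π * Equiv.swap (pairSnd (pairIndex (π.symm a))) (pairSnd (pairIndex (π.symm b)))
  else Equiv.swap a b * π

/-- No index lies between `a` and `b`, so only the comparison of `a` with `b` itself is reversed. -/
theorem swap_lt_swap_of_adjacent {n : ℕ} {a b u v : Fin n} (hab : (b : ℕ) = a + 1) (huv : u < v)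
    (h : ¬ (u = a ∧ v = b)) : Equiv.swap a b u < Equiv.swap a b v := by
  simp only [Equiv.swap_apply_def, Fin.ext_iff, Fin.lt_def] at hab huv h ⊢
  split_ifs <;> omega

/-- Each case is stable under its own move: exchanging partners leaves the positions of `a` and `b`
alone, and exchanging the values merely interchanges these positions. Two moves are needed because,
if `a` and `b` both come first in their pairs, exchanging the values would violate the order of the
first elements; exchanging the partners produces the same matching in its normal form. -/
theorem swapAdjacent_involutive {n : ℕ} (a b : Fin (2 * n))
    (π : Equiv.Perm (Fin (2 * n))) : swapAdjacent a b (swapAdjacent a b π) = π := by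
  by_cases h1 : pairIndex (π.symm a) = pairIndex (π.symm b)
  · have : swapAdjacent a b π = π := if_pos h1
    rw [this, this]
  by_cases h2 : π.symm a = pairFst (pairIndex (π.symm a)) ∧
      π.symm b = pairFst (pairIndex (π.symm b))
  · have h3 : swapAdjacent a b π =
        π * Equiv.swap (pairSnd (pairIndex (π.symm a))) (pairSnd (pairIndex (π.symm b))) := by
      unfold swapAdjacent
      rw [if_neg h1, if_pos h2]
    have hs : ∀ c, (∃ k, c = pairFst k) →
        (π * Equiv.swap (pairSnd (pairIndex (π.symm a))) (pairSnd (pairIndex (π.symm b)))).symm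
          (π c) = c := by
      rintro _ ⟨k, rfl⟩
      rw [Equiv.symm_apply_eq, Equiv.Perm.mul_apply, Equiv.swap_apply_of_ne_of_ne
        (pairFst_ne_pairSnd _ _) (pairFst_ne_pairSnd _ _)]
    have ha := hs (π.symm a) ⟨_, h2.1⟩
    have hb := hs (π.symm b) ⟨_, h2.2⟩
    rw [Equiv.apply_symm_apply] at ha hb
    rw [h3]
    unfold swapAdjacent
    rw [ha, hb, if_neg h1, if_pos h2, mul_assoc, Equiv.swap_mul_self, mul_one]
  · have h3 : swapAdjacent a b π = Equiv.swap a b * π := by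
      unfold swapAdjacent
      rw [if_neg h1, if_neg h2]
    have ha : (Equiv.swap a b * π).symm a = π.symm b := by
      rw [Equiv.symm_apply_eq, Equiv.Perm.mul_apply, Equiv.apply_symm_apply,
        Equiv.swap_apply_right]
    have hb : (Equiv.swap a b * π).symm b = π.symm a := by
      rw [Equiv.symm_apply_eq, Equiv.Perm.mul_apply, Equiv.apply_symm_apply,
        Equiv.swap_apply_left]
    rw [h3]
    unfold swapAdjacent
    rw [ha, hb, if_neg (Ne.symm h1), if_neg (fun h => h2 h.symm), ← mul_assoc,
      Equiv.swap_mul_self, one_mul]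

/-- The pfaffian vanishes if two adjacent rows agree. -/
theorem pfaffian_eq_zero_of_adjacent {n : ℕ} {A : Matrix (Fin (2 * n)) (Fin (2 * n)) ℂ}
    {a b : Fin (2 * n)} (hab : (b : ℕ) = a + 1) (h0 : A a b = 0)
    (hl : ∀ u, u < a → A u a = A u b) (hr : ∀ v, b < v → A a v = A b v) : pfaffian A = 0 := by
  have hlt : a < b := by rw [Fin.lt_def]; omega
  have hswap : ∀ u v, u < v → ¬ (u = a ∧ v = b) →
      A (Equiv.swap a b u) (Equiv.swap a b v) = A u v := by
    intro u v huv h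
    rcases eq_or_ne u a with rfl | hua
    · have hvb : v ≠ b := fun h' => h ⟨rfl, h'⟩
      rw [Equiv.swap_apply_left, Equiv.swap_apply_of_ne_of_ne huv.ne' hvb]
      exact (hr v (by rw [Fin.lt_def] at *; rw [Ne, Fin.ext_iff] at hvb; omega)).symm
    rcases eq_or_ne u b with rfl | hub
    · rw [Equiv.swap_apply_right, Equiv.swap_apply_of_ne_of_ne (hlt.trans huv).ne' huv.ne']
      exact hr v huv
    rw [Equiv.swap_apply_of_ne_of_ne hua hub]
    rcases eq_or_ne v a with rfl | hva
    · rw [Equiv.swap_apply_left]; exact (hl u huv).symm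
    rcases eq_or_ne v b with rfl | hvb
    · rw [Equiv.swap_apply_right]
      exact hl u (by rw [Fin.lt_def] at *; rw [Ne, Fin.ext_iff] at hua; omega)
    rw [Equiv.swap_apply_of_ne_of_ne hva hvb]
  have key : ∀ π ∈ pfaffianPerms n, swapAdjacent a b π ∈ pfaffianPerms n ∧
      ((Equiv.Perm.sign π : ℤ) : ℂ) * ∏ i : Fin n, A (π (pairFst i)) (π (pairSnd i)) +
        ((Equiv.Perm.sign (swapAdjacent a b π) : ℤ) : ℂ) *
          ∏ i : Fin n, A (swapAdjacent a b π (pairFst i)) (swapAdjacent a b π (pairSnd i)) = 0 ∧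
      (((Equiv.Perm.sign π : ℤ) : ℂ) * ∏ i : Fin n, A (π (pairFst i)) (π (pairSnd i)) ≠ 0 →
        swapAdjacent a b π ≠ π) := by
    intro π hπ
    have hπ' := mem_pfaffianPerms.1 hπ
    have hpair : ∀ i, π (pairFst i) = a → π (pairSnd i) = b →
        pairIndex (π.symm a) = pairIndex (π.symm b) := by
      intro i h h'
      rw [← h, ← h', Equiv.symm_apply_apply, Equiv.symm_apply_apply, pairIndex_pairFst,
        pairIndex_pairSnd]
    by_cases h1 : pairIndex (π.symm a) = pairIndex (π.symm b)
    · have h2 : swapAdjacent a b π = π := if_pos h1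
      -- Fixed points of the involution match `a` with `b`, and contribute nothing because `A a b =
      -- 0`.
      have hz : ∏ i : Fin n, A (π (pairFst i)) (π (pairSnd i)) = 0 := by
        refine Finset.prod_eq_zero (Finset.mem_univ (pairIndex (π.symm a))) ?_
        have hlt' := hπ'.2 (pairIndex (π.symm a))
        have hne : π.symm a ≠ π.symm b := fun h => hlt.ne (π.symm.injective h)
        have hA := eq_pairFst_or_pairSnd_pairIndex (π.symm a)
        have hB := eq_pairFst_or_pairSnd_pairIndex (π.symm b)
        rw [← h1] at hB
        rcases hA with hA | hA <;> rcases hB with hB | hB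
        · exact absurd (hA.trans hB.symm) hne
        · rw [← hA, ← hB, Equiv.apply_symm_apply, Equiv.apply_symm_apply, h0]
        · rw [← hA, ← hB, Equiv.apply_symm_apply, Equiv.apply_symm_apply] at hlt'
          exact absurd hlt' hlt.not_gt
        · exact absurd (hA.trans hB.symm) hne
      refine ⟨by rwa [h2], by rw [h2, hz]; simp, fun h => absurd (by rw [hz]; simp) h⟩
    by_cases h2 : π.symm a = pairFst (pairIndex (π.symm a)) ∧
        π.symm b = pairFst (pairIndex (π.symm b))
    · set k := pairIndex (π.symm a) with hk
      set l := pairIndex (π.symm b) with hl'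
      have h3 : swapAdjacent a b π = π * Equiv.swap (pairSnd k) (pairSnd l) := by
        unfold swapAdjacent
        rw [← hk, ← hl', if_neg h1, if_pos h2]
      have hne : pairSnd k ≠ pairSnd l := fun h => h1 (pairSnd_injective h)
      have hak : π (pairFst k) = a := by rw [← h2.1]; simp
      have hbl : π (pairFst l) = b := by rw [← h2.2]; simp
      have hf : ∀ i, (π * Equiv.swap (pairSnd k) (pairSnd l)) (pairFst i) = π (pairFst i) := by
        intro i
        rw [Equiv.Perm.mul_apply, Equiv.swap_apply_of_ne_of_ne
          (pairFst_ne_pairSnd _ _) (pairFst_ne_pairSnd _ _)]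
      have hsn : ∀ i, (π * Equiv.swap (pairSnd k) (pairSnd l)) (pairSnd i) =
          π (pairSnd (Equiv.swap k l i)) := by
        intro i
        rw [Equiv.Perm.mul_apply]
        congr 1
        rcases eq_or_ne i k with rfl | hik
        · simp
        rcases eq_or_ne i l with rfl | hil
        · simp
        rw [Equiv.swap_apply_of_ne_of_ne hik hil, Equiv.swap_apply_of_ne_of_ne
          (fun h => hik (pairSnd_injective h)) (fun h => hil (pairSnd_injective h))]
      have hbk : b < π (pairSnd k) := by
        have h4 := hπ'.2 k
        have h5 : π (pairSnd k) ≠ b := by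
          rw [← hbl]
          exact fun h => pairFst_ne_pairSnd _ _ (π.injective h).symm
        rw [hak] at h4
        rw [Fin.lt_def] at *; rw [Ne, Fin.ext_iff] at h5; omega
      have hbl' : b < π (pairSnd l) := by
        have h4 := hπ'.2 l
        rwa [hbl] at h4
      refine ⟨?_, ?_, ?_⟩
      · rw [h3, mem_pfaffianPerms]
        refine ⟨fun i j hij => by rw [hf, hf]; exact hπ'.1 i j hij, fun i => ?_⟩
        rw [hf, hsn]
        rcases eq_or_ne i k with rfl | hik
        · rw [Equiv.swap_apply_left, hak]; exact hlt.trans hbl'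
        rcases eq_or_ne i l with rfl | hil
        · rw [Equiv.swap_apply_right, hbl]; exact hbk
        rw [Equiv.swap_apply_of_ne_of_ne hik hil]
        exact hπ'.2 i
      · have hprod : ∏ i : Fin n, A (swapAdjacent a b π (pairFst i))
            (swapAdjacent a b π (pairSnd i)) =
              ∏ i : Fin n, A (π (pairFst i)) (π (pairSnd i)) := by
          rw [← Equiv.prod_comp (Equiv.swap k l) (fun i => A (π (pairFst i)) (π (pairSnd i)))]
          refine Finset.prod_congr rfl fun i _ => ?_
          rw [h3, hf, hsn]
          rcases eq_or_ne i k with rfl | hik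
          · rw [Equiv.swap_apply_left, hak, hbl, hr _ hbl']
          rcases eq_or_ne i l with rfl | hil
          · rw [Equiv.swap_apply_right, hak, hbl, hr _ hbk]
          rw [Equiv.swap_apply_of_ne_of_ne hik hil]
        rw [hprod, h3, Equiv.Perm.sign_mul, Equiv.Perm.sign_swap hne]
        push_cast
        ring
      · intro _ h
        rw [h3] at h
        have h4 := mul_eq_left.1 h
        have h5 := DFunLike.congr_fun h4 (pairSnd k)
        rw [Equiv.swap_apply_left] at h5
        exact hne h5.symm
    · have h3 : swapAdjacent a b π = Equiv.swap a b * π := by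
        unfold swapAdjacent
        rw [if_neg h1, if_neg h2]
      refine ⟨?_, ?_, ?_⟩
      · rw [h3, mem_pfaffianPerms]
        refine ⟨fun i j hij => ?_, fun i => ?_⟩
        · rw [Equiv.Perm.mul_apply, Equiv.Perm.mul_apply]
          refine swap_lt_swap_of_adjacent hab (hπ'.1 i j hij) ?_
          rintro ⟨hi, hj⟩
          refine h2 ⟨?_, ?_⟩
          · rw [← hi, Equiv.symm_apply_apply, pairIndex_pairFst]
          · rw [← hj, Equiv.symm_apply_apply, pairIndex_pairFst]
        · rw [Equiv.Perm.mul_apply, Equiv.Perm.mul_apply]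
          exact swap_lt_swap_of_adjacent hab (hπ'.2 i) fun h => h1 (hpair i h.1 h.2)
      · have hprod : ∏ i : Fin n, A (swapAdjacent a b π (pairFst i))
            (swapAdjacent a b π (pairSnd i)) =
              ∏ i : Fin n, A (π (pairFst i)) (π (pairSnd i)) := by
          refine Finset.prod_congr rfl fun i _ => ?_
          rw [h3, Equiv.Perm.mul_apply, Equiv.Perm.mul_apply]
          exact hswap _ _ (hπ'.2 i) fun h => h1 (hpair i h.1 h.2)
        rw [hprod, h3, Equiv.Perm.sign_mul, Equiv.Perm.sign_swap hlt.ne]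
        push_cast
        ring
      · intro _ h
        rw [h3] at h
        have h4 := DFunLike.congr_fun h (π.symm a)
        rw [Equiv.Perm.mul_apply, Equiv.apply_symm_apply, Equiv.swap_apply_left] at h4
        exact hlt.ne' h4
  exact Finset.sum_involution (fun π _ => swapAdjacent a b π) (fun π hπ => (key π hπ).2.1)
    (fun π hπ => (key π hπ).2.2) (fun π hπ => (key π hπ).1)
    (fun π _ => swapAdjacent_involutive a b π)

theorem pfaffian_zero (A : Matrix (Fin (2 * 0)) (Fin (2 * 0)) ℂ) : pfaffian A = 1 := by
  have : pfaffianPerms 0 = Finset.univ := by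
    rw [Finset.eq_univ_iff_forall]
    intro π
    rw [mem_pfaffianPerms]
    exact ⟨fun i => i.elim0, fun i => i.elim0⟩
  simp [pfaffian, this]

/-- The upper triangular matrix with all entries above the diagonal equal to `1` has pfaffian
`1`. -/
theorem pfaffian_one_above {n : ℕ} {A : Matrix (Fin (2 * n)) (Fin (2 * n)) ℂ}
    (hA : ∀ u v, u < v → A u v = 1) : pfaffian A = 1 := by
  induction n with
  | zero => exact pfaffian_zero A
  | succ n ih =>
    -- The first row is split into its entry in column `1` and the rest. The rest makes rows `0` and
    -- `1` agree with a zero between them, so only the expansion along the single entry survives.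
    let B : Matrix (Fin (2 * n + 1 + 1)) (Fin (2 * n + 1 + 1)) ℂ := fun u v =>
      if u = 0 then (if v = Fin.succ 0 then 1 else 0) else A u v
    let C : Matrix (Fin (2 * n + 1 + 1)) (Fin (2 * n + 1 + 1)) ℂ := fun u v =>
      if u = 0 then (if v = Fin.succ 0 then 0 else 1) else A u v
    have h1 : pfaffian A = pfaffian (n := n + 1) B + 1 * pfaffian (n := n + 1) C := by
      refine pfaffian_add_row (n := n + 1) (0 : Fin (2 * n + 1 + 1)) 1 ?_ ?_
      · intro u v _ hu _
        simp only [B, C]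
        exact ⟨(if_neg hu).symm, (if_neg hu).symm⟩
      · intro u v huv h
        have hu : u = (0 : Fin (2 * n + 1 + 1)) := by
          rcases h with h | h
          · exact h
          · rw [h] at huv
            exact absurd huv (Fin.not_lt_zero _)
        rw [hA u v huv]
        simp only [B, C]
        rw [if_pos hu, if_pos hu]
        split_ifs <;> simp
    have h2 : pfaffian (n := n + 1) C = 0 := by
      refine pfaffian_eq_zero_of_adjacent (n := n + 1) (a := (0 : Fin (2 * n + 1 + 1)))
        (b := (Fin.succ 0 : Fin (2 * n + 1 + 1))) rfl ?_ ?_ ?_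
      · simp [C]
      · intro u hu
        exact absurd hu (Fin.not_lt_zero _)
      · intro v hv
        simp only [C]
        rw [if_pos True.intro, if_neg hv.ne', if_neg (Fin.succ_ne_zero _)]
        exact (hA _ _ hv).symm
    have h3 := pfaffian_row_single B 0 (fun j hj => by
      simp only [B]
      rw [if_pos True.intro, if_neg]
      exact fun h => hj (Fin.succ_injective _ h))
    have h4 : pfaffian (fun u v : Fin (2 * n) => B ((Fin.succAbove 0 u).succ)
        ((Fin.succAbove 0 v).succ)) = 1 := by
      refine ih fun u v huv => ?_
      simp only [B]
      rw [if_neg (Fin.succ_ne_zero _)]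
      refine hA _ _ ?_
      exact Fin.succ_lt_succ_iff.2 (Fin.succ_lt_succ_iff.2 huv)
    refine h1.trans ?_
    rw [h2, h3, h4]
    simp [B]

end SchurQ

/-! ### Fillings by time -/

namespace SchurQ

/-- The box `q` lies strictly to the right of `p` in the same row, or strictly below it in the same
column. -/
def Before (p q : ℕ × ℕ) : Prop := (p.1 = q.1 ∧ p.2 < q.2) ∨ (p.2 = q.2 ∧ p.1 < q.1)

open Classical in
/-- The ways to fill the boxes of `D` one after another before the time `m`, where only boxes `b`
with `κ b = c i` can be filled at time `i`. -/
noncomputable def schedules (c : ℕ → ℕ) (m : ℕ) (D : Finset (ℕ × ℕ)) (κ : ℕ × ℕ → ℕ) :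
    Finset (D → ℕ) :=
  (Fintype.piFinset fun _ : D => Finset.range m).filter fun T =>
    (∀ b, c (T b) = κ b.1) ∧ ∀ p q : D, Before p.1 q.1 → T p < T q

/-- The generating function of `schedules`, when a box filled at time `i` has weight `x i`. -/
noncomputable def scheduleSum (c : ℕ → ℕ) (x : ℕ → ℂ) (m : ℕ) (D : Finset (ℕ × ℕ))
    (κ : ℕ × ℕ → ℕ) : ℂ :=
  ∑ T ∈ schedules c m D κ, ∏ b, x (T b)

variable {c : ℕ → ℕ} {x : ℕ → ℂ} {m : ℕ} {D : Finset (ℕ × ℕ)} {κ : ℕ × ℕ → ℕ}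

theorem mem_schedules {T : D → ℕ} : T ∈ schedules c m D κ ↔
    (∀ b, T b < m) ∧ (∀ b, c (T b) = κ b.1) ∧ ∀ p q : D, Before p.1 q.1 → T p < T q := by
  simp [schedules]

theorem scheduleSum_empty : scheduleSum c x m ∅ κ = 1 := by
  have : schedules c m ∅ κ = {fun b => absurd b.2 (Finset.notMem_empty _)} := by
    ext T
    rw [mem_schedules, Finset.mem_singleton]
    constructor
    · intro _
      ext b
      exact absurd b.2 (Finset.notMem_empty _)
    · intro _
      exact ⟨fun b => absurd b.2 (Finset.notMem_empty _),
        fun b => absurd b.2 (Finset.notMem_empty _),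
        fun b => absurd b.2 (Finset.notMem_empty _)⟩
  rw [scheduleSum, this, Finset.sum_singleton]
  simp

theorem scheduleSum_zero (hD : D.Nonempty) : scheduleSum c x 0 D κ = 0 := by
  obtain ⟨b, hb⟩ := hD
  refine Finset.sum_eq_zero fun T hT => ?_
  exact absurd ((mem_schedules.1 hT).1 ⟨b, hb⟩) (Nat.not_lt_zero _)

/-- A box filled at the last instant `m` has label `c m` and precedes no other box; under the
hypothesis no such box exists. -/
theorem scheduleSum_succ_of_forall
    (h : ∀ b ∈ D, κ b = c m → ∃ b' ∈ D, Before b b') :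
    scheduleSum c x (m + 1) D κ = scheduleSum c x m D κ := by
  have : schedules c (m + 1) D κ = schedules c m D κ := by
    ext T
    rw [mem_schedules, mem_schedules]
    constructor
    · rintro ⟨h1, h2, h3⟩
      refine ⟨fun b => ?_, h2, h3⟩
      refine lt_of_le_of_ne (Nat.lt_succ_iff.1 (h1 b)) fun hm => ?_
      obtain ⟨b', hb', hbb⟩ := h b.1 b.2 (by rw [← h2, hm])
      have h4 := h3 b ⟨b', hb'⟩ hbb
      have h5 := h1 ⟨b', hb'⟩
      omega
    · rintro ⟨h1, h2, h3⟩
      exact ⟨fun b => (h1 b).trans (Nat.lt_succ_self m), h2, h3⟩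
  rw [scheduleSum, this, scheduleSum]

/-- Only `b₀` can be filled at the instant `m`. The two summands collect the schedules in which it
is filled earlier and those in which it is filled at `m`; in the latter case, being maximal, it puts
no constraint on the remaining boxes. -/
theorem scheduleSum_succ_of_maximal {b₀ : ℕ × ℕ} (hb₀ : b₀ ∈ D) (hκ : κ b₀ = c m)
    (hmax : ∀ b ∈ D, ¬ Before b₀ b)
    (h : ∀ b ∈ D, b ≠ b₀ → κ b = c m → ∃ b' ∈ D, Before b b') :
    scheduleSum c x (m + 1) D κ =
      scheduleSum c x m D κ + x m * scheduleSum c x m (D.erase b₀) κ := by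
  have hne : ∀ T ∈ schedules c (m + 1) D κ, ∀ b : D, b.1 ≠ b₀ → T b < m := by
    intro T hT b hb
    obtain ⟨h1, h2, h3⟩ := mem_schedules.1 hT
    refine lt_of_le_of_ne (Nat.lt_succ_iff.1 (h1 b)) fun hm => ?_
    obtain ⟨b', hb', hbb⟩ := h b.1 b.2 hb (by rw [← h2, hm])
    have h4 := h3 b ⟨b', hb'⟩ hbb
    have h5 := h1 ⟨b', hb'⟩
    omega
  rw [scheduleSum, ← Finset.sum_filter_add_sum_filter_not _ (fun T => T ⟨b₀, hb₀⟩ < m)]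
  congr 1
  · refine Finset.sum_congr ?_ fun _ _ => rfl
    ext T
    rw [Finset.mem_filter]
    constructor
    · rintro ⟨hT, h0⟩
      refine mem_schedules.2 ⟨fun b => ?_, (mem_schedules.1 hT).2⟩
      rcases eq_or_ne b.1 b₀ with hb | hb
      · have : b = ⟨b₀, hb₀⟩ := Subtype.ext hb
        rwa [this]
      · exact hne T hT b hb
    · intro hT
      obtain ⟨h1, h2, h3⟩ := mem_schedules.1 hT
      exact ⟨mem_schedules.2 ⟨fun b => (h1 b).trans (Nat.lt_succ_self m), h2, h3⟩, h1 _⟩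
  · rw [scheduleSum, Finset.mul_sum]
    symm
    refine Finset.sum_bij'
      (fun (T : ↥(D.erase b₀) → ℕ) _ => fun b : D =>
        if hb : b.1 = b₀ then m else T ⟨b.1, Finset.mem_erase.2 ⟨hb, b.2⟩⟩)
      (fun (T : D → ℕ) _ => fun b => T ⟨b.1, Finset.mem_of_mem_erase b.2⟩) ?_ ?_ ?_ ?_ ?_
    · intro T hT
      obtain ⟨h1, h2, h3⟩ := mem_schedules.1 hT
      rw [Finset.mem_filter, mem_schedules]
      refine ⟨⟨fun b => ?_, fun b => ?_, fun p q hpq => ?_⟩, ?_⟩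
      · split_ifs with hb
        · exact Nat.lt_succ_self m
        · exact (h1 _).trans (Nat.lt_succ_self m)
      · split_ifs with hb
        · rw [hb, hκ]
        · exact h2 _
      · have hp : p.1 ≠ b₀ := by
          intro hp
          rw [hp] at hpq
          exact hmax _ q.2 hpq
        rw [dif_neg hp]
        split_ifs with hq
        · exact h1 _
        · exact h3 _ _ hpq
      · simp
    · intro T hT
      rw [Finset.mem_filter] at hT
      obtain ⟨h1, h2, h3⟩ := mem_schedules.1 hT.1
      refine mem_schedules.2 ⟨fun b => ?_, fun b => h2 _, fun p q hpq => h3 _ _ hpq⟩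
      exact hne T hT.1 _ (Finset.ne_of_mem_erase b.2)
    · intro T _
      ext b
      exact dif_neg (Finset.ne_of_mem_erase b.2)
    · intro T hT
      rw [Finset.mem_filter] at hT
      ext b
      dsimp only
      split_ifs with hb
      · have hb' : b = ⟨b₀, hb₀⟩ := Subtype.ext hb
        have := (mem_schedules.1 hT.1).1 b
        rw [hb'] at this ⊢
        omega
      · rfl
    · intro T _
      rw [← Finset.mul_prod_erase _ _ (Finset.mem_univ (⟨b₀, hb₀⟩ : D))]
      dsimp only
      rw [dif_pos rfl]
      congr 1
      refine Finset.prod_bij' (fun b _ => (⟨b.1, Finset.mem_of_mem_erase b.2⟩ : D))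
        (fun b hb => ⟨b.1, Finset.mem_erase.2
          ⟨fun h' => Finset.ne_of_mem_erase hb (Subtype.ext h'), b.2⟩⟩) ?_ ?_ ?_ ?_ ?_
      · intro b _
        refine Finset.mem_erase.2 ⟨fun h' => ?_, Finset.mem_univ _⟩
        exact Finset.ne_of_mem_erase b.2 (congrArg Subtype.val h')
      · intro b _
        exact Finset.mem_univ _
      · intro b _; rfl
      · intro b _; rfl
      · intro b _
        rw [dif_neg (Finset.ne_of_mem_erase b.2)]

/-- The part of the rows `0, …, r - 1` of the shifted diagram of `lam` outside that of `mu`. -/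
def skewRegion (r : ℕ) (lam mu : ℕ → ℕ) : Finset (ℕ × ℕ) :=
  (Finset.range r).biUnion fun i => (Finset.Ico (i + mu i) (i + lam i)).image fun j => (i, j)

theorem mem_skewRegion {r : ℕ} {lam mu : ℕ → ℕ} {b : ℕ × ℕ} :
    b ∈ skewRegion r lam mu ↔ b.1 < r ∧ b.1 + mu b.1 ≤ b.2 ∧ b.2 < b.1 + lam b.1 := by
  obtain ⟨i, j⟩ := b
  simp only [skewRegion, Finset.mem_biUnion, Finset.mem_range, Finset.mem_image, Finset.mem_Ico,
    Prod.mk.injEq]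
  constructor
  · rintro ⟨_, h1, _, h2, rfl, rfl⟩
    exact ⟨h1, h2⟩
  · rintro ⟨h1, h2⟩
    exact ⟨i, h1, j, h2, rfl, rfl⟩

/-- A strict partition with at most `r` nonzero parts, followed by zeros. -/
structure IsStrictPartition (r : ℕ) (lam : ℕ → ℕ) : Prop where
  succ_eq_zero_or_lt : ∀ i, lam (i + 1) = 0 ∨ lam (i + 1) < lam i
  eq_zero : ∀ i, r ≤ i → lam i = 0

theorem IsStrictPartition.eq_zero_or_lt {r : ℕ} {lam : ℕ → ℕ} (h : IsStrictPartition r lam)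
    {i j : ℕ} (hij : i < j) : lam j = 0 ∨ lam j < lam i := by
  induction j, hij using Nat.le_induction with
  | base => exact h.succ_eq_zero_or_lt i
  | succ j _ ih =>
    rcases h.succ_eq_zero_or_lt j with h1 | h1
    · exact Or.inl h1
    · right; omega

theorem IsStrictPartition.lt_of_ne_zero {r : ℕ} {lam : ℕ → ℕ} (h : IsStrictPartition r lam)
    {i : ℕ} (hi : lam i ≠ 0) : i < r := by
  by_contra h'
  exact hi (h.eq_zero i (not_lt.1 h'))

theorem IsStrictPartition.update {r k : ℕ} {lam : ℕ → ℕ} (h : IsStrictPartition r lam)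
    {i : ℕ} (hi : lam i = k + 1) (hk : k = 0 ∨ lam (i + 1) ≠ k) :
    IsStrictPartition r (Function.update lam i k) := by
  constructor
  · intro j
    have h1 := h.succ_eq_zero_or_lt j
    simp only [Function.update_apply]
    split_ifs with h2 h3 h3
    · omega
    · subst h2; omega
    · subst h3; omega
    · exact h1
  · intro j hj
    have : j ≠ i := by
      rintro rfl
      have := h.eq_zero j hj
      omega
    rw [Function.update_of_ne this]
    exact h.eq_zero j hj

open Classical in
/-- The generating function of `schedules` for the skew shape `lam/mu`, with contents as labels. -/
noncomputable def skewSum (c : ℕ → ℕ) (x : ℕ → ℂ) (r : ℕ) (mu : ℕ → ℕ) (m : ℕ)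
    (lam : ℕ → ℕ) : ℂ :=
  if ∀ i, mu i ≤ lam i then scheduleSum c x m (skewRegion r lam mu) (fun b => b.2 - b.1) else 0

/-! ### The recursion in time for skew shifted shapes -/

section
variable {r s : ℕ} {lam mu : ℕ → ℕ}

/-- If the row does not end at content `k`, the box has a right neighbour. If it does and the next
part is `k ≠ 0`, the last box of the next row lies directly below; it is outside the diagram of `mu`
because `mu` is strict. -/
theorem exists_before_of_content {k : ℕ} (hlam : IsStrictPartition r lam)
    (hmu : IsStrictPartition s mu) {b : ℕ × ℕ}
    (hb : b ∈ skewRegion r lam mu) (hbk : b.2 - b.1 = k)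
    (h : lam b.1 ≠ k + 1 ∨ (k ≠ 0 ∧ lam (b.1 + 1) = k)) :
    ∃ b' ∈ skewRegion r lam mu, Before b b' := by
  obtain ⟨i, j⟩ := b
  obtain ⟨h1, h2, h3⟩ := mem_skewRegion.1 hb
  dsimp only at *
  by_cases h4 : lam i = k + 1
  · have h5 : k ≠ 0 ∧ lam (i + 1) = k := by tauto
    refine ⟨(i + 1, j), mem_skewRegion.2 ⟨?_, ?_, ?_⟩, Or.inr ⟨rfl, Nat.lt_succ_self i⟩⟩
    · exact hlam.lt_of_ne_zero (by dsimp only; omega)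
    · have := hmu.succ_eq_zero_or_lt i
      dsimp only; omega
    · dsimp only; omega
  · refine ⟨(i, j + 1), mem_skewRegion.2 ⟨h1, ?_, ?_⟩, Or.inl ⟨rfl, Nat.lt_succ_self j⟩⟩
    · dsimp only; omega
    · dsimp only; omega

theorem skewSum_succ_of_forall_ne (hlam : IsStrictPartition r lam) (hmu : IsStrictPartition s mu)
    (h : ∀ i, lam i ≠ c m + 1) :
    skewSum c x r mu (m + 1) lam = skewSum c x r mu m lam := by
  unfold skewSum
  split_ifs
  · exact scheduleSum_succ_of_forall fun b hb hk =>
      exists_before_of_content hlam hmu hb hk (Or.inl (h _))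
  · rfl

theorem skewSum_succ_of_blocked (hlam : IsStrictPartition r lam) (hmu : IsStrictPartition s mu)
    {i : ℕ} (hi : lam i = c m + 1) (h0 : c m ≠ 0) (h1 : lam (i + 1) = c m) :
    skewSum c x r mu (m + 1) lam = skewSum c x r mu m lam := by
  unfold skewSum
  split_ifs
  · refine scheduleSum_succ_of_forall fun b hb hk =>
      exists_before_of_content hlam hmu hb hk ?_
    by_cases h2 : b.1 = i
    · right; rw [h2]; exact ⟨h0, h1⟩
    · left
      intro h3
      rcases lt_or_gt_of_ne h2 with h4 | h4
      · have := hlam.eq_zero_or_lt h4; omega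
      · have := hlam.eq_zero_or_lt h4; omega
  · rfl

theorem skewSum_succ_of_eq (hlam : IsStrictPartition r lam) (hmu : IsStrictPartition s mu)
    {i : ℕ} (hi : lam i = c m + 1) (h1 : c m = 0 ∨ lam (i + 1) ≠ c m) :
    skewSum c x r mu (m + 1) lam =
      skewSum c x r mu m lam + x m * skewSum c x r mu m (Function.update lam i (c m)) := by
  classical
  have hir : i < r := hlam.lt_of_ne_zero (by omega)
  have huniq : ∀ j, j ≠ i → lam j ≠ c m + 1 := by
    intro j hj h3
    rcases lt_or_gt_of_ne hj with h4 | h4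
    · have := hlam.eq_zero_or_lt h4; omega
    · have := hlam.eq_zero_or_lt h4; omega
  by_cases hsub : ∀ j, mu j ≤ lam j
  swap
  · have : ¬ ∀ j, mu j ≤ Function.update lam i (c m) j := by
      intro h
      refine hsub fun j => ?_
      have := h j
      rw [Function.update_apply] at this
      split_ifs at this with hj
      · subst hj; omega
      · exact this
    simp [skewSum, hsub, this]
  by_cases hmi : mu i ≤ c m
  · have hsub' : ∀ j, mu j ≤ Function.update lam i (c m) j := by
      intro j
      rw [Function.update_apply]
      split_ifs with hj
      · subst hj; exact hmi
      · exact hsub j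
    simp only [skewSum, if_pos hsub, if_pos hsub']
    have herase : skewRegion r (Function.update lam i (c m)) mu =
        (skewRegion r lam mu).erase (i, i + c m) := by
      ext ⟨a, b⟩
      rw [Finset.mem_erase, mem_skewRegion, mem_skewRegion]
      simp only [Function.update_apply, ne_eq, Prod.mk.injEq]
      split_ifs with ha
      · subst ha; omega
      · simp [ha]
    rw [herase]
    refine scheduleSum_succ_of_maximal (mem_skewRegion.2 ⟨hir, ?_, ?_⟩) ?_ ?_ ?_
    · dsimp only; omega
    · dsimp only; omega
    · dsimp only; omega
    · rintro ⟨a, b⟩ hb hbef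
      obtain ⟨h2, h3, h4⟩ := mem_skewRegion.1 hb
      dsimp only at h2 h3 h4
      rcases hbef with ⟨h5, h6⟩ | ⟨h5, h6⟩
      · dsimp only at h5 h6
        subst h5
        omega
      · dsimp only at h5 h6
        have h7 := hlam.eq_zero_or_lt h6
        have h8 := hlam.succ_eq_zero_or_lt i
        rcases eq_or_ne a (i + 1) with rfl | h9
        · omega
        · have h10 := hlam.eq_zero_or_lt (i := i + 1) (j := a) (by omega)
          -- The ends of the nonempty rows weakly decrease, so row `i + 1` already decides whether
          -- any box lies below `(i, i + c m)`.
          have h11 : lam a + a ≤ lam (i + 1) + (i + 1) ∨ lam a = 0 := by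
            clear h2 h3 h4 h5 h7 h8 h10 hb
            have : i + 1 ≤ a := by omega
            clear h6 h9
            induction a, this using Nat.le_induction with
            | base => left; exact le_rfl
            | succ a _ ih =>
              have := hlam.succ_eq_zero_or_lt a
              omega
          omega
    · intro b hb hne hk
      refine exists_before_of_content hlam hmu hb hk (Or.inl (huniq _ ?_))
      intro h2
      obtain ⟨h3, h4, h5⟩ := mem_skewRegion.1 hb
      exact hne (Prod.ext h2 (by dsimp only; omega))
  -- Here `mu i = lam i`: row `i` of the skew shape is empty, and the lowered partition no longer
  -- contains `mu`, so its term is zero by convention.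
  · have hsub' : ¬ ∀ j, mu j ≤ Function.update lam i (c m) j := by
      intro h
      have := h i
      rw [Function.update_self] at this
      exact hmi this
    simp only [skewSum, if_pos hsub, if_neg hsub', mul_zero, add_zero]
    refine scheduleSum_succ_of_forall fun b hb hk =>
      exists_before_of_content hlam hmu hb hk (Or.inl (huniq _ ?_))
    intro h2
    obtain ⟨h3, h4, h5⟩ := mem_skewRegion.1 hb
    rw [h2] at h4
    omega

open Classical in
theorem skewSum_zero (hlam : IsStrictPartition r lam) :
    skewSum c x r mu 0 lam = if lam = mu then 1 else 0 := by
  unfold skewSum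
  split_ifs with h1 h2 h2
  · have : skewRegion r lam mu = ∅ := by
      ext b
      rw [mem_skewRegion, h2]
      simp only [Finset.notMem_empty, iff_false]
      omega
    rw [this, scheduleSum_empty]
  · refine scheduleSum_zero ?_
    obtain ⟨i, hi⟩ := Function.ne_iff.1 h2
    have := h1 i
    exact ⟨(i, i + mu i), mem_skewRegion.2
      ⟨hlam.lt_of_ne_zero (by dsimp only; omega), by dsimp only; omega, by dsimp only; omega⟩⟩
  · exact absurd (fun i => h2 ▸ le_rfl) h1
  · rfl

end

end SchurQ

/-! ### The pfaffian formula for generating functions of fillings by time -/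

namespace SchurQ

variable {c : ℕ → ℕ} {x : ℕ → ℂ} {m : ℕ}

/-- The sequence `a, b, 0, 0, …`. -/
def pairShape (a b : ℕ) : ℕ → ℕ := fun i => if i = 0 then a else if i = 1 then b else 0

theorem isStrictPartition_pairShape {a b : ℕ} (h : b = 0 ∨ b < a) :
    IsStrictPartition 2 (pairShape a b) := by
  constructor
  · intro i
    rcases i with _ | i
    · simpa [pairShape] using h
    · simp [pairShape]
  · intro i hi
    simp only [pairShape]
    rw [if_neg (by omega), if_neg (by omega)]

theorem isStrictPartition_zero (r : ℕ) : IsStrictPartition r fun _ => 0 :=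
  ⟨fun _ => Or.inl rfl, fun _ _ => rfl⟩

/-- The generating function of `schedules` for the shape `(a, b)`. -/
noncomputable def pairSum (c : ℕ → ℕ) (x : ℕ → ℂ) (m a b : ℕ) : ℂ :=
  skewSum c x 2 (fun _ => 0) m (pairShape a b)

/-- The generating function of `schedules` for the skew shape `(a)/(b)`. -/
noncomputable def rowSum (c : ℕ → ℕ) (x : ℕ → ℂ) (m a b : ℕ) : ℂ :=
  if b ≤ a then scheduleSum c x m (shiftedDiagram ![a - b]) (fun p => b + p.2) else 0

theorem pairSum_succ_of_ne {a b : ℕ} (h : b = 0 ∨ b < a) (ha : a ≠ c m + 1) (hb : b ≠ c m + 1) :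
    pairSum c x (m + 1) a b = pairSum c x m a b := by
  refine skewSum_succ_of_forall_ne (isStrictPartition_pairShape h) (isStrictPartition_zero 0) ?_
  intro i
  simp only [pairShape]
  split_ifs <;> omega

theorem pairSum_succ_left {b : ℕ} (hb : b ≤ c m) (h : c m = 0 ∨ b ≠ c m) :
    pairSum c x (m + 1) (c m + 1) b =
      pairSum c x m (c m + 1) b + x m * pairSum c x m (c m) b := by
  have h1 := skewSum_succ_of_eq (x := x) (m := m) (c := c)
    (isStrictPartition_pairShape (a := c m + 1) (b := b) (by omega)) (isStrictPartition_zero 0)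
    (i := 0) (by simp [pairShape]) (by simpa [pairShape] using h)
  have h2 : Function.update (pairShape (c m + 1) b) 0 (c m) = pairShape (c m) b := by
    ext i
    simp only [Function.update_apply, pairShape]
    split_ifs <;> rfl
  rwa [h2] at h1

theorem pairSum_succ_blocked (h : c m ≠ 0) :
    pairSum c x (m + 1) (c m + 1) (c m) = pairSum c x m (c m + 1) (c m) :=
  skewSum_succ_of_blocked (isStrictPartition_pairShape (by omega)) (isStrictPartition_zero 0)
    (i := 0) (by simp [pairShape]) h (by simp [pairShape])

theorem pairSum_succ_right {a : ℕ} (ha : c m + 1 < a) :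
    pairSum c x (m + 1) a (c m + 1) =
      pairSum c x m a (c m + 1) + x m * pairSum c x m a (c m) := by
  have h1 := skewSum_succ_of_eq (x := x) (m := m) (c := c)
    (isStrictPartition_pairShape (a := a) (b := c m + 1) (by omega)) (isStrictPartition_zero 0)
    (i := 1) (by simp [pairShape]) (by simp only [pairShape]; norm_num; omega)
  have h2 : Function.update (pairShape a (c m + 1)) 1 (c m) = pairShape a (c m) := by
    ext i
    simp only [Function.update_apply, pairShape]
    split_ifs <;> first | rfl | omega
  rwa [h2] at h1

theorem pairSum_zero {a b : ℕ} (h : b = 0 ∨ b < a) :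
    pairSum c x 0 a b = if a = 0 then 1 else 0 := by
  classical
  rw [pairSum, skewSum_zero (isStrictPartition_pairShape h)]
  refine if_congr ⟨fun h' => congrFun h' 0, fun h' => ?_⟩ rfl rfl
  ext i
  simp only [pairShape]
  split_ifs <;> omega

theorem mem_shiftedDiagram_single {l : ℕ} {b : ℕ × ℕ} :
    b ∈ shiftedDiagram ![l] ↔ b.1 = 0 ∧ b.2 < l := by
  rw [mem_shiftedDiagram]
  simp only [Fin.exists_fin_one, Fin.val_zero, Matrix.cons_val_fin_one]
  omega

theorem rowSum_succ_of_ne {a b : ℕ} (ha : a ≠ c m + 1) :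
    rowSum c x (m + 1) a b = rowSum c x m a b := by
  unfold rowSum
  split_ifs with h
  · refine scheduleSum_succ_of_forall ?_
    rintro ⟨i, j⟩ hb hk
    obtain ⟨h1, h2⟩ := mem_shiftedDiagram_single.1 hb
    dsimp only at h1 h2 hk
    exact ⟨(i, j + 1), mem_shiftedDiagram_single.2 ⟨h1, by dsimp only; omega⟩,
      Or.inl ⟨rfl, Nat.lt_succ_self j⟩⟩
  · rfl

theorem rowSum_succ (b : ℕ) : rowSum c x (m + 1) (c m + 1) b =
    rowSum c x m (c m + 1) b + x m * rowSum c x m (c m) b := by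
  unfold rowSum
  by_cases h : b ≤ c m
  · rw [if_pos h, if_pos (by omega), if_pos (by omega)]
    have h1 : shiftedDiagram ![c m - b] =
        (shiftedDiagram ![c m + 1 - b]).erase (0, c m - b) := by
      ext ⟨i, j⟩
      rw [Finset.mem_erase, mem_shiftedDiagram_single, mem_shiftedDiagram_single]
      simp only [ne_eq, Prod.mk.injEq]
      omega
    rw [h1]
    refine scheduleSum_succ_of_maximal
      (mem_shiftedDiagram_single.2 ⟨rfl, by dsimp only; omega⟩) (by dsimp only; omega) ?_ ?_
    · rintro ⟨i, j⟩ hb hbef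
      obtain ⟨h3, h4⟩ := mem_shiftedDiagram_single.1 hb
      unfold Before at hbef
      dsimp only at *
      omega
    · rintro ⟨i, j⟩ hb hne hk
      obtain ⟨h3, h4⟩ := mem_shiftedDiagram_single.1 hb
      refine absurd (Prod.ext h3 ?_) hne
      dsimp only at *
      omega
  · rw [if_neg h, mul_zero, add_zero]
    -- Either `b = c m + 1`, and the shape is empty at both times, or `b` is larger and both sides
    -- are zero by convention.
    split_ifs with h1
    · have : shiftedDiagram ![c m + 1 - b] = ∅ := by
        ext p
        rw [mem_shiftedDiagram_single]
        simp only [Finset.notMem_empty, iff_false]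
        omega
      rw [this, scheduleSum_empty, scheduleSum_empty]
    · rfl

theorem rowSum_zero (a b : ℕ) : rowSum c x 0 a b = if a = b then 1 else 0 := by
  unfold rowSum
  split_ifs with h1 h2 h2
  · have : shiftedDiagram ![a - b] = ∅ := by
      ext p
      rw [mem_shiftedDiagram_single]
      simp only [Finset.notMem_empty, iff_false]
      omega
    rw [this, scheduleSum_empty]
  · exact scheduleSum_zero ⟨(0, 0), mem_shiftedDiagram_single.2 ⟨rfl, by dsimp only; omega⟩⟩
  · omega
  · rfl

/-- The matrix with blocks `(F (lam u) (lam v))`, for `u < v < r`, and `(G (lam u) (mu k))`, the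
columns of the latter being in the order of decreasing `k`. -/
def skewMatrix (F G : ℕ → ℕ → ℂ) (r n : ℕ) (lam mu : ℕ → ℕ) :
    Matrix (Fin (2 * n)) (Fin (2 * n)) ℂ := fun u v =>
  if (u : ℕ) < r then
    if (v : ℕ) < r then F (lam u) (lam v) else G (lam u) (mu (2 * n - 1 - v))
  else 0

/-! ### The recursion in time for the pfaffian and its initial value -/

section
variable {r n : ℕ} {lam mu : ℕ → ℕ}

theorem pfaffian_skewMatrix_succ_of_forall_ne (hlam : IsStrictPartition r lam)
    (h : ∀ i, lam i ≠ c m + 1) :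
    pfaffian (skewMatrix (pairSum c x (m + 1)) (rowSum c x (m + 1)) r n lam mu) =
      pfaffian (skewMatrix (pairSum c x m) (rowSum c x m) r n lam mu) := by
  refine pfaffian_congr fun u v huv => ?_
  unfold skewMatrix
  split_ifs
  · exact pairSum_succ_of_ne (hlam.eq_zero_or_lt huv) (h _) (h _)
  · exact rowSum_succ_of_ne (h _)
  · rfl

-- Only the index `i` carries the part `c m + 1`, so all changing entries involve `i`. Each changes
-- by `x m` times the entry of the lowered shape, except that a pair `(c m + 1, c m)` with `c m ≠ 0`
-- is blocked. Its would-be lowered shape `(c m, c m)` is not strict, and the entry is replaced by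
-- `0`.
open Classical in
theorem pfaffian_skewMatrix_succ_aux (hlam : IsStrictPartition r lam) (hr : r ≤ 2 * n)
    {i : ℕ} (hi : lam i = c m + 1) :
    pfaffian (skewMatrix (pairSum c x (m + 1)) (rowSum c x (m + 1)) r n lam mu) =
      pfaffian (skewMatrix (pairSum c x m) (rowSum c x m) r n lam mu) +
      x m * pfaffian (fun u v => if c m ≠ 0 ∧ (u : ℕ) = i ∧ (v : ℕ) < r ∧ lam v = c m then 0 else
        skewMatrix (pairSum c x m) (rowSum c x m) r n (Function.update lam i (c m)) mu u v) := by
  have hir : i < r := hlam.lt_of_ne_zero (by omega)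
  have huniq : ∀ j, j ≠ i → lam j ≠ c m + 1 := by
    intro j hj h3
    rcases lt_or_gt_of_ne hj with h4 | h4
    · have := hlam.eq_zero_or_lt h4; omega
    · have := hlam.eq_zero_or_lt h4; omega
  refine pfaffian_add_row ⟨i, hir.trans_le hr⟩ (x m) ?_ ?_
  · intro u v huv hu hv
    have hu' : (u : ℕ) ≠ i := fun h => hu (Fin.ext h)
    have hv' : (v : ℕ) ≠ i := fun h => hv (Fin.ext h)
    have h1 : skewMatrix (pairSum c x (m + 1)) (rowSum c x (m + 1)) r n lam mu u v =
        skewMatrix (pairSum c x m) (rowSum c x m) r n lam mu u v := by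
      unfold skewMatrix
      split_ifs
      · exact pairSum_succ_of_ne (hlam.eq_zero_or_lt huv) (huniq _ hu') (huniq _ hv')
      · exact rowSum_succ_of_ne (huniq _ hu')
      · rfl
    refine ⟨h1, h1.trans ?_⟩
    rw [if_neg (fun h => hu' h.2.1)]
    unfold skewMatrix
    rw [Function.update_of_ne hu', Function.update_of_ne hv']
  · intro u v huv huvi
    have hlt : (u : ℕ) < v := huv
    rcases huvi with rfl | rfl
    · have hvi : (v : ℕ) ≠ i := hlt.ne'
      unfold skewMatrix
      dsimp only at hlt ⊢
      rw [if_pos hir, if_pos hir, if_pos hir, hi, Function.update_self,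
        Function.update_of_ne hvi]
      by_cases hvr : (v : ℕ) < r
      · have h2 := hlam.eq_zero_or_lt hlt
        rw [if_pos hvr, if_pos hvr, if_pos hvr]
        split_ifs with h3
        · rw [h3.2.2.2, pairSum_succ_blocked h3.1, mul_zero, add_zero]
        · refine pairSum_succ_left (by omega) ?_
          by_contra h4
          push Not at h4
          exact h3 ⟨h4.1, rfl, hvr, h4.2⟩
      · rw [if_neg hvr, if_neg hvr, if_neg hvr, if_neg (fun h => hvr h.2.2.1)]
        exact rowSum_succ _
    · have hui : (u : ℕ) ≠ i := hlt.ne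
      unfold skewMatrix
      dsimp only at hlt ⊢
      rw [if_neg (fun h : c m ≠ 0 ∧ (u : ℕ) = i ∧ i < r ∧ lam i = c m => hui h.2.1),
        if_pos (hlt.trans hir), if_pos (hlt.trans hir),
        if_pos (hlt.trans hir), if_pos hir, if_pos hir, if_pos hir, hi, Function.update_self,
        Function.update_of_ne hui]
      refine pairSum_succ_right ?_
      have := hlam.eq_zero_or_lt hlt
      omega

/-- After lowering, the adjacent indices `i` and `i + 1` both carry the part `c m`, and the entry
joining them has been set to `0`; hence the extra pfaffian vanishes. -/
theorem pfaffian_skewMatrix_succ_of_blocked (hlam : IsStrictPartition r lam) (hr : r ≤ 2 * n)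
    {i : ℕ} (hi : lam i = c m + 1) (h0 : c m ≠ 0) (h1 : lam (i + 1) = c m) :
    pfaffian (skewMatrix (pairSum c x (m + 1)) (rowSum c x (m + 1)) r n lam mu) =
      pfaffian (skewMatrix (pairSum c x m) (rowSum c x m) r n lam mu) := by
  have hir : i + 1 < r := hlam.lt_of_ne_zero (by omega)
  refine (pfaffian_skewMatrix_succ_aux hlam hr hi).trans ?_
  rw [add_eq_left, mul_eq_zero]
  right
  refine pfaffian_eq_zero_of_adjacent (a := ⟨i, by omega⟩) (b := ⟨i + 1, by omega⟩) rfl ?_ ?_ ?_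
  · exact if_pos ⟨h0, rfl, hir, h1⟩
  · intro u hu
    have hu' : (u : ℕ) < i := hu
    rw [if_neg (fun h => hu'.ne h.2.1), if_neg (fun h => hu'.ne h.2.1)]
    unfold skewMatrix
    dsimp only
    rw [if_pos hir, if_pos (by omega : i < r), Function.update_self,
      Function.update_of_ne (by omega : (u : ℕ) ≠ i),
      Function.update_of_ne (by omega : i + 1 ≠ i), h1]
  · intro v hv
    have hv' : i + 1 < (v : ℕ) := hv
    have h2 := hlam.eq_zero_or_lt hv'
    rw [if_neg (by omega), if_neg (by dsimp only; omega)]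
    unfold skewMatrix
    dsimp only
    rw [if_pos hir, if_pos (by omega : i < r), Function.update_self,
      Function.update_of_ne (by omega : i + 1 ≠ i), h1]

theorem pfaffian_skewMatrix_succ_of_eq (hlam : IsStrictPartition r lam) (hr : r ≤ 2 * n)
    {i : ℕ} (hi : lam i = c m + 1) (h1 : c m = 0 ∨ lam (i + 1) ≠ c m) :
    pfaffian (skewMatrix (pairSum c x (m + 1)) (rowSum c x (m + 1)) r n lam mu) =
      pfaffian (skewMatrix (pairSum c x m) (rowSum c x m) r n lam mu) +
      x m * pfaffian (skewMatrix (pairSum c x m) (rowSum c x m) r n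
        (Function.update lam i (c m)) mu) := by
  rw [pfaffian_skewMatrix_succ_aux hlam hr hi]
  congr 2
  -- The correction entry never occurs: by strictness a later part equal to `c m ≠ 0` would have to
  -- be the next one.
  refine pfaffian_congr fun u v huv => if_neg ?_
  rintro ⟨h2, h3, h4, h5⟩
  have huv' : (u : ℕ) < v := huv
  rcases eq_or_ne (v : ℕ) (i + 1) with h6 | h6
  · rw [h6] at h5; omega
  · have := hlam.eq_zero_or_lt (i := i + 1) (j := v) (by omega)
    have := hlam.succ_eq_zero_or_lt i
    omega

/-- The value of the pfaffian when no letters are available. -/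
theorem pfaffian_skewMatrix_initial {F G : ℕ → ℕ → ℂ}
    (hF : ∀ a b, b = 0 ∨ b < a → F a b = if a = 0 then 1 else 0)
    (hG : ∀ a b, G a b = if a = b then 1 else 0) :
    ∀ {n r : ℕ} {lam mu : ℕ → ℕ}, r ≤ 2 * n → IsStrictPartition r lam →
      IsStrictPartition (2 * n - r) mu → (∀ i j, i < j → j < 2 * n - r → mu j < mu i) →
      ∀ [Decidable (lam = mu)], pfaffian (skewMatrix F G r n lam mu) =
        if lam = mu then 1 else 0 := by
  intro n
  induction n with
  | zero =>
    intro r lam mu hr hlam hmu _ _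
    rw [pfaffian_zero, if_pos]
    ext i
    rw [hlam.eq_zero i (by omega), hmu.eq_zero i (by omega)]
  | succ n ih =>
    intro r lam mu hr hlam hmu hmu' _
    -- The columns are in reverse order, so the last one belongs to the largest part `mu 0`.
    have hlast : (∀ u, u < r → u < 2 * n + 1 → ¬ lam u = mu 0) → r < 2 * (n + 1) →
        pfaffian (skewMatrix F G r (n + 1) lam mu) = 0 := by
      intro h h'
      refine pfaffian_eq_zero_of_row (Fin.last (2 * n + 1)) ?_
      intro u v huv h1
      have hv : v = Fin.last (2 * n + 1) := by
        rcases h1 with h1 | h1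
        · rw [h1] at huv
          exact absurd huv (Fin.le_last _).not_gt
        · exact h1
      have hvv : (v : ℕ) = 2 * n + 1 := by rw [hv]; rfl
      have hlt : (u : ℕ) < v := huv
      unfold skewMatrix
      split_ifs with h2 h3
      · omega
      · rw [hG, if_neg]
        have : 2 * (n + 1) - 1 - (v : ℕ) = 0 := by omega
        rw [this]
        exact h _ h2 (by omega)
      · rfl
    have hle : ∀ u, lam u ≤ lam 0 := by
      intro u
      rcases Nat.eq_zero_or_pos u with rfl | hu
      · exact le_rfl
      · have := hlam.eq_zero_or_lt hu
        omega
    by_cases hmr : r < 2 * (n + 1)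
    · by_cases hgt : lam 0 < mu 0
      · rw [hlast (fun u _ _ => by have := hle u; omega) hmr, if_neg]
        rintro rfl
        exact lt_irrefl _ hgt
      by_cases hr0 : r = 0
      · have h1 := hmu' 0 1 (by omega) (by omega)
        have h2 := hlam.eq_zero 0 (by omega)
        omega
      by_cases hl0 : lam 0 = 0
      · have hlam0 : ∀ i, lam i = 0 := fun i => by have := hle i; omega
        -- Now `mu 0 = 0`, and strict decrease allows no second part. All entries above the diagonal
        -- are then `1`, whatever the number of zeros in `lam`.
        have hm : 2 * (n + 1) - r = 1 := by
          by_contra hne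
          have := hmu' 0 1 (by omega) (by omega)
          omega
        have hmu0 : ∀ i, mu i = 0 := by
          intro i
          rcases Nat.eq_zero_or_pos i with rfl | hi
          · omega
          · exact hmu.eq_zero i (by omega)
        rw [if_pos (funext fun i => by rw [hlam0, hmu0])]
        refine pfaffian_one_above fun u v huv => ?_
        have hlt : (u : ℕ) < v := huv
        have hv2 := v.2
        unfold skewMatrix
        rw [if_pos (by omega), hlam0, hlam0, hmu0, hF 0 0 (Or.inl rfl), hG]
        simp
      · have hrow : ∀ j : Fin (2 * n + 1), j ≠ Fin.last (2 * n) →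
            skewMatrix F G r (n + 1) lam mu (0 : Fin (2 * n + 1 + 1))
              (j.succ : Fin (2 * n + 1 + 1)) = 0 ∨ lam 0 ≠ mu 0 := by
          intro j hj
          by_cases heq : lam 0 = mu 0
          swap
          · exact Or.inr heq
          left
          have hj' : (j : ℕ) < 2 * n := by
            have h1 := j.2
            have h2 : (j : ℕ) ≠ 2 * n := fun h => hj (Fin.ext h)
            omega
          have h0 : (((0 : Fin (2 * n + 1 + 1)) : Fin (2 * (n + 1))) : ℕ) = 0 := rfl
          have h1 : (((j.succ : Fin (2 * n + 1 + 1)) : Fin (2 * (n + 1))) : ℕ) = j + 1 := rfl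
          unfold skewMatrix
          rw [h0, h1, if_pos (by omega)]
          split_ifs with h2
          · rw [hF _ _ (hlam.eq_zero_or_lt (by omega)), if_neg hl0]
          · rw [hG, if_neg]
            have h3 := hmu' 0 (2 * (n + 1) - 1 - (j + 1)) (by omega) (by omega)
            omega
        by_cases heq : lam 0 = mu 0
        -- The first row has a single nonzero entry, in the last column. The expansion removes the
        -- largest parts of both partitions, with sign `(-1) ^ (2 * n) = 1`.
        · have h1 := pfaffian_row_single (skewMatrix F G r (n + 1) lam mu) (Fin.last (2 * n))
            (fun j hj => (hrow j hj).resolve_right (not_not.2 heq))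
          have h2 : skewMatrix F G r (n + 1) lam mu (0 : Fin (2 * n + 1 + 1))
              ((Fin.last (2 * n)).succ : Fin (2 * n + 1 + 1)) = 1 := by
            have h0 : (((0 : Fin (2 * n + 1 + 1)) : Fin (2 * (n + 1))) : ℕ) = 0 := rfl
            have h1 : ((((Fin.last (2 * n)).succ : Fin (2 * n + 1 + 1)) : Fin (2 * (n + 1))) : ℕ)
              = 2 * n + 1 := rfl
            unfold skewMatrix
            rw [h0, h1, if_pos (by omega), if_neg (by omega), hG,
              show 2 * (n + 1) - 1 - (2 * n + 1) = 0 by omega, if_pos heq]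
          have h3 : pfaffian (fun u v : Fin (2 * n) => skewMatrix F G r (n + 1) lam mu
              (((Fin.last (2 * n)).succAbove u).succ : Fin (2 * n + 1 + 1))
              (((Fin.last (2 * n)).succAbove v).succ : Fin (2 * n + 1 + 1))) =
              pfaffian (skewMatrix F G (r - 1) n (fun i => lam (i + 1)) fun i => mu (i + 1)) := by
            refine pfaffian_congr fun u v _ => ?_
            have hval : ∀ w : Fin (2 * n), (((((Fin.last (2 * n)).succAbove w).succ :
                Fin (2 * n + 1 + 1)) : Fin (2 * (n + 1))) : ℕ) = w + 1 := by
              intro w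
              rw [Fin.succAbove_last]
              rfl
            have hv2 := v.2
            unfold skewMatrix
            rw [hval, hval]
            rw [if_congr (show (u : ℕ) + 1 < r ↔ (u : ℕ) < r - 1 by omega)
              (if_congr (show (v : ℕ) + 1 < r ↔ (v : ℕ) < r - 1 by omega) rfl rfl) rfl,
              show 2 * (n + 1) - 1 - ((v : ℕ) + 1) = 2 * n - 1 - v + 1 by omega]
          have h4 : IsStrictPartition (r - 1) (fun i => lam (i + 1)) :=
            ⟨fun i => hlam.succ_eq_zero_or_lt (i + 1), fun i hi => hlam.eq_zero _ (by omega)⟩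
          have h5 : IsStrictPartition (2 * n - (r - 1)) (fun i => mu (i + 1)) :=
            ⟨fun i => hmu.succ_eq_zero_or_lt (i + 1), fun i hi => hmu.eq_zero _ (by omega)⟩
          classical
          have h6 := ih (r := r - 1) (by omega) h4 h5
            (fun i j hij hj => hmu' _ _ (by omega) (by omega))
          rw [h1, h2, h3, h6]
          have h7 : ((fun i => lam (i + 1)) = fun i => mu (i + 1)) ↔ lam = mu := by
            constructor
            · intro h
              ext i
              rcases i with _ | i
              · exact heq
              · exact congrFun h i
            · rintro rfl
              rfl
          rw [if_congr h7 rfl rfl]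
          simp
        · rw [if_neg (fun h => heq (congrFun h 0))]
          by_cases hex : ∃ k, k < 2 * (n + 1) - r ∧ mu k = lam 0
          · exfalso
            obtain ⟨k, hk, hk'⟩ := hex
            rcases Nat.eq_zero_or_pos k with rfl | hk0
            · exact heq hk'.symm
            · have := hmu' 0 k hk0 hk
              omega
          · push Not at hex
            refine pfaffian_eq_zero_of_row (0 : Fin (2 * n + 1 + 1)) fun u v huv h1 => ?_
            have hu : u = (0 : Fin (2 * n + 1 + 1)) := by
              rcases h1 with h1 | h1
              · exact h1
              · rw [h1] at huv
                exact absurd huv (Fin.not_lt_zero _)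
            have hu0 : (u : ℕ) = 0 := by rw [hu]; rfl
            have hlt : (u : ℕ) < v := huv
            have hv2 := v.2
            unfold skewMatrix
            rw [hu0, if_pos (by omega)]
            split_ifs with h2
            · rw [hF _ _ (hlam.eq_zero_or_lt (by omega)), if_neg hl0]
            · rw [hG, if_neg]
              exact fun h => hex _ (by omega) h.symm
    · have hmu0 : ∀ i, mu i = 0 := fun i => hmu.eq_zero i (by omega)
      have hr' : r = 2 * (n + 1) := by omega
      by_cases hl0 : lam 0 = 0
      · have hlam0 : ∀ i, lam i = 0 := fun i => by have := hle i; omega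
        rw [if_pos (funext fun i => by rw [hlam0, hmu0])]
        refine pfaffian_one_above fun u v huv => ?_
        have hu2 := u.2
        have hv2 := v.2
        unfold skewMatrix
        rw [if_pos (by omega), if_pos (by omega), hlam0, hlam0, hF 0 0 (Or.inl rfl), if_pos rfl]
      · rw [if_neg (fun h => hl0 (by rw [h, hmu0]))]
        refine pfaffian_eq_zero_of_row (0 : Fin (2 * n + 1 + 1)) fun u v huv h1 => ?_
        have hu : u = (0 : Fin (2 * n + 1 + 1)) := by
          rcases h1 with h1 | h1
          · exact h1
          · rw [h1] at huv
            exact absurd huv (Fin.not_lt_zero _)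
        have hu0 : (u : ℕ) = 0 := by rw [hu]; rfl
        have hlt : (u : ℕ) < v := huv
        have hv2 := v.2
        unfold skewMatrix
        rw [hu0, if_pos (by omega), if_pos (by omega),
          hF _ _ (hlam.eq_zero_or_lt (by omega)), if_neg hl0]

/-- The pfaffian formula for the generating functions of `schedules`. -/
theorem skewSum_eq_pfaffian (hr : r ≤ 2 * n) (hmu : IsStrictPartition (2 * n - r) mu)
    (hmu' : ∀ i j, i < j → j < 2 * n - r → mu j < mu i) (m : ℕ) (hlam : IsStrictPartition r lam) :
    skewSum c x r mu m lam =
      pfaffian (skewMatrix (pairSum c x m) (rowSum c x m) r n lam mu) := by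
  induction m generalizing lam with
  | zero =>
    classical
    rw [skewSum_zero hlam, pfaffian_skewMatrix_initial (fun a b h => pairSum_zero h)
      (fun a b => rowSum_zero a b) hr hlam hmu hmu']
  | succ m ih =>
    by_cases h : ∃ i, lam i = c m + 1
    · obtain ⟨i, hi⟩ := h
      by_cases hb : c m = 0 ∨ lam (i + 1) ≠ c m
      · rw [skewSum_succ_of_eq hlam hmu hi hb, pfaffian_skewMatrix_succ_of_eq hlam hr hi hb,
          ih hlam, ih (hlam.update hi hb)]
      · push Not at hb
        rw [skewSum_succ_of_blocked hlam hmu hi hb.1 hb.2,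
          pfaffian_skewMatrix_succ_of_blocked hlam hr hi hb.1 hb.2, ih hlam]
    · push Not at h
      rw [skewSum_succ_of_forall_ne hlam hmu h, pfaffian_skewMatrix_succ_of_forall_ne hlam h,
        ih hlam]

end

end SchurQ

/-! ### Tableaux as fillings by time -/

namespace SchurQ

/-- The number of letters before a given one. -/
def Letter.index (l : Letter) : ℕ := 2 * (l.abs - 1) + (ofLex l).2.toNat

/-- The letter with a given number of letters before it. -/
def Letter.ofIndex (e : ℕ) : Letter := toLex (⟨e / 2 + 1, Nat.succ_pos _⟩, decide (e % 2 = 1))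

theorem Letter.abs_pos (l : Letter) : 0 < l.abs := (ofLex l).1.2

theorem Letter.index_ofIndex (e : ℕ) : (Letter.ofIndex e).index = e := by
  have h : (Letter.ofIndex e).abs = e / 2 + 1 := rfl
  have h' : (ofLex (Letter.ofIndex e)).2 = decide (e % 2 = 1) := rfl
  rw [Letter.index, h, h']
  rcases Nat.mod_two_eq_zero_or_one e with h0 | h0
  · rw [h0]; simp; omega
  · rw [h0]; simp; omega

theorem Letter.index_lt_index {l l' : Letter} : l.index < l'.index ↔ l < l' := by
  obtain ⟨⟨k, b⟩, rfl⟩ := toLex.surjective l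
  obtain ⟨⟨k', b'⟩, rfl⟩ := toLex.surjective l'
  rw [Prod.Lex.toLex_lt_toLex]
  simp only [Letter.index, Letter.abs, ofLex_toLex]
  rw [← PNat.coe_lt_coe, ← PNat.coe_inj]
  have hk : 0 < (k : ℕ) := k.pos
  have hk' : 0 < (k' : ℕ) := k'.pos
  generalize (k : ℕ) = a at *
  generalize (k' : ℕ) = a' at *
  have hb : b < b' ↔ b.toNat < b'.toNat := by
    cases b <;> cases b' <;> simp
  rw [hb]
  have h1 := b.toNat_le
  have h2 := b'.toNat_le
  omega

theorem Letter.index_injective : Function.Injective Letter.index := by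
  intro l l' h
  rcases lt_trichotomy l l' with h' | h' | h'
  · exact absurd h (Letter.index_lt_index.2 h').ne
  · exact h'
  · exact absurd h (Letter.index_lt_index.2 h').ne'

theorem Letter.index_le_index {l l' : Letter} : l.index ≤ l'.index ↔ l ≤ l' := by
  rw [← not_lt, Letter.index_lt_index, not_lt]

theorem Letter.ofIndex_index (l : Letter) : Letter.ofIndex l.index = l :=
  Letter.index_injective (Letter.index_ofIndex _)

theorem Letter.isMarked_iff {l : Letter} : l.IsMarked ↔ l.index % 2 = 0 := by
  rw [Letter.IsMarked, Letter.index]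
  cases (ofLex l).2 <;> simp

theorem Letter.abs_eq {l : Letter} : l.abs = l.index / 2 + 1 := by
  have := l.abs_pos
  rw [Letter.index]
  cases (ofLex l).2 <;> simp <;> omega

/-- The time at which a letter is put into a box of content `k < L`: the letters are used in
increasing order, the marked ones in the order of decreasing contents and the unmarked ones in the
order of increasing contents. -/
def Letter.time (L : ℕ) (l : Letter) (k : ℕ) : ℕ :=
  l.index * L + if l.index % 2 = 0 then L - 1 - k else k

/-- The content of the boxes that can be filled at a given time. -/
def timeContent (L m : ℕ) : ℕ := if (m / L) % 2 = 0 then L - 1 - m % L else m % L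

/-- The weight of a box filled at a given time. -/
noncomputable def timeWeight (L : ℕ) (z : ℕ → ℂ) (m : ℕ) : ℂ :=
  1 / (((m / L) / 2 + 1 : ℕ) : ℂ) ^ z (timeContent L m)

theorem Letter.time_div {L k : ℕ} (hk : k < L) (l : Letter) : l.time L k / L = l.index := by
  unfold Letter.time
  rw [mul_comm, Nat.mul_add_div (by omega), Nat.div_eq_of_lt, add_zero]
  split_ifs <;> omega

theorem Letter.time_mod {L k : ℕ} (hk : k < L) (l : Letter) :
    l.time L k % L = if l.index % 2 = 0 then L - 1 - k else k := by
  unfold Letter.time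
  rw [mul_comm, Nat.mul_add_mod, Nat.mod_eq_of_lt]
  split_ifs <;> omega

theorem timeContent_time {L k : ℕ} (hk : k < L) (l : Letter) :
    timeContent L (l.time L k) = k := by
  unfold timeContent
  rw [Letter.time_div hk, Letter.time_mod hk]
  split_ifs
  · omega
  · rfl

theorem timeWeight_time {L k : ℕ} (hk : k < L) (z : ℕ → ℂ) (l : Letter) :
    timeWeight L z (l.time L k) = 1 / (l.abs : ℂ) ^ z k := by
  rw [timeWeight, timeContent_time hk, Letter.time_div hk, Letter.abs_eq]

theorem Letter.time_ofIndex {L k m : ℕ} (hk : k < L) (hm : timeContent L m = k) :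
    (Letter.ofIndex (m / L)).time L k = m := by
  unfold Letter.time
  rw [Letter.index_ofIndex]
  unfold timeContent at hm
  have h1 := Nat.div_add_mod' m L
  have h2 : m % L < L := Nat.mod_lt _ (by omega)
  split_ifs at hm ⊢ <;> omega

/-- Different letters occupy disjoint blocks of `L` instants, in the order of the letters; within a
block the content decides. -/
theorem Letter.time_lt_time {L k k' : ℕ} (hk : k < L) (hk' : k' < L) {l l' : Letter} :
    l.time L k < l'.time L k' ↔ l < l' ∨ (l = l' ∧
      if l.index % 2 = 0 then k' < k else k < k') := by
  have h1 := Letter.time_div hk l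
  have h2 := Letter.time_div hk' l'
  rcases lt_trichotomy l l' with h | h | h
  · simp only [h, true_or, iff_true]
    by_contra hn
    have := Nat.div_le_div_right (c := L) (not_lt.1 hn)
    rw [h1, h2] at this
    exact absurd (Letter.index_lt_index.2 h) this.not_gt
  · subst h
    simp only [lt_irrefl, false_or, true_and]
    unfold Letter.time
    split_ifs <;> omega
  · simp only [h.not_gt, h.ne', false_and, or_false, iff_false, not_lt]
    by_contra hn
    have := Nat.div_le_div_right (c := L) (not_le.1 hn).le
    rw [h1, h2] at this
    exact absurd (Letter.index_lt_index.2 h) this.not_gt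

theorem Letter.time_lt_iff {L k N : ℕ} (hk : k < L) (l : Letter) :
    l.time L k < 2 * N * L ↔ l.abs ≤ N := by
  rw [← Nat.div_lt_iff_lt_mul (by omega), Letter.time_div hk, Letter.abs_eq]
  omega

/-- The function `κ` behaves like the content on the set `D` of boxes. -/
structure IsContent (L : ℕ) (D : Finset (ℕ × ℕ)) (κ : ℕ × ℕ → ℕ) : Prop where
  lt : ∀ b ∈ D, κ b < L
  row : ∀ p ∈ D, ∀ q ∈ D, p.1 = q.1 → p.2 < q.2 → κ p < κ q
  col : ∀ p ∈ D, ∀ q ∈ D, p.2 = q.2 → p.1 < q.1 → κ q < κ p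

section
variable {L : ℕ} {D : Finset (ℕ × ℕ)} {κ : ℕ × ℕ → ℕ}

/-- Between boxes with equal letters, strict increase of time means that the content falls for a
marked letter and rises for an unmarked one. Since contents rise along rows and fall down columns,
this forbids exactly the repetition of a marked letter in a row and of an unmarked letter in a
column. -/
theorem isQSST_iff (h : IsContent L D κ) {t : D → Letter} :
    IsQSST D t ↔ ∀ p q : D, Before p.1 q.1 →
      (t p).time L (κ p.1) < (t q).time L (κ q.1) := by
  have hlt : ∀ p q : D, (t p).time L (κ p.1) < (t q).time L (κ q.1) ↔ t p < t q ∨ (t p = t q ∧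
      if (t p).index % 2 = 0 then κ q.1 < κ p.1 else κ p.1 < κ q.1) := fun p q =>
    Letter.time_lt_time (h.lt _ p.2) (h.lt _ q.2)
  simp only [hlt]
  constructor
  · rintro ⟨h1, h2, h3, h4⟩ p q hpq
    rcases hpq with ⟨h5, h6⟩ | ⟨h5, h6⟩
    · rcases (h1 p q h5 h6.le).lt_or_eq with h7 | h7
      · exact Or.inl h7
      · refine Or.inr ⟨h7, ?_⟩
        rw [if_neg]
        · exact h.row _ p.2 _ q.2 h5 h6
        · intro h8
          have := h3 p q h5 h7 (Letter.isMarked_iff.2 h8)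
          rw [this] at h6
          exact lt_irrefl _ h6
    · rcases (h2 p q h5 h6.le).lt_or_eq with h7 | h7
      · exact Or.inl h7
      · refine Or.inr ⟨h7, ?_⟩
        rw [if_pos]
        · exact h.col _ p.2 _ q.2 h5 h6
        · by_contra h8
          have := h4 p q h5 h7 (fun h9 => h8 (Letter.isMarked_iff.1 h9))
          rw [this] at h6
          exact lt_irrefl _ h6
  · intro h0
    have hrow : ∀ p q : D, p.1.1 = q.1.1 → p.1.2 < q.1.2 → t p = t q → ¬ (t p).IsMarked := by
      intro p q h1 h2 h3 h4
      rcases h0 p q (Or.inl ⟨h1, h2⟩) with h5 | ⟨_, h5⟩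
      · exact h5.ne h3
      · rw [if_pos (Letter.isMarked_iff.1 h4)] at h5
        exact lt_asymm h5 (h.row _ p.2 _ q.2 h1 h2)
    have hcol : ∀ p q : D, p.1.2 = q.1.2 → p.1.1 < q.1.1 → t p = t q → (t p).IsMarked := by
      intro p q h1 h2 h3
      by_contra h4
      rcases h0 p q (Or.inr ⟨h1, h2⟩) with h5 | ⟨_, h5⟩
      · exact h5.ne h3
      · rw [if_neg (fun h6 => h4 (Letter.isMarked_iff.2 h6))] at h5
        exact lt_asymm h5 (h.col _ p.2 _ q.2 h1 h2)
    refine ⟨fun p q h1 h2 => ?_, fun p q h1 h2 => ?_, fun p q h1 h2 h3 => ?_,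
      fun p q h1 h2 h3 => ?_⟩
    · rcases h2.lt_or_eq with h3 | h3
      · rcases h0 p q (Or.inl ⟨h1, h3⟩) with h4 | h4
        · exact h4.le
        · exact h4.1.le
      · rw [show p = q from Subtype.ext (Prod.ext h1 h3)]
    · rcases h2.lt_or_eq with h3 | h3
      · rcases h0 p q (Or.inr ⟨h1, h3⟩) with h4 | h4
        · exact h4.le
        · exact h4.1.le
      · rw [show p = q from Subtype.ext (Prod.ext h3 h1)]
    · rcases lt_trichotomy p.1.2 q.1.2 with h4 | h4 | h4
      · exact absurd h3 (hrow p q h1 h4 h2)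
      · exact Subtype.ext (Prod.ext h1 h4)
      · exact absurd (h2 ▸ h3) (hrow q p h1.symm h4 h2.symm)
    · rcases lt_trichotomy p.1.1 q.1.1 with h4 | h4 | h4
      · exact absurd (hcol p q h1 h4 h2) h3
      · exact Subtype.ext (Prod.ext h4 h1)
      · exact absurd (hcol q p h1.symm h4 h2.symm) (h2 ▸ h3)

theorem zetaQUpTo_eq_scheduleSum (h : IsContent L D κ) {z : ℕ → ℂ} {s : ℕ × ℕ → ℂ}
    (hs : ∀ b ∈ D, s b = z (κ b)) (N : ℕ) :
    zetaQUpTo N D s = scheduleSum (timeContent L) (timeWeight L z) (2 * N * L) D κ := by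
  refine Finset.sum_bij' (fun (t : D → Letter) _ => fun b => (t b).time L (κ b.1))
    (fun (T : D → ℕ) _ => fun b => Letter.ofIndex (T b / L)) ?_ ?_ ?_ ?_ ?_
  · intro t ht
    rw [Set.Finite.mem_toFinset] at ht
    refine mem_schedules.2 ⟨fun b => ?_, fun b => timeContent_time (h.lt _ b.2) _,
      (isQSST_iff h).1 ht.1⟩
    exact (Letter.time_lt_iff (h.lt _ b.2) _).2 (ht.2 b)
  · intro T hT
    obtain ⟨h1, h2, h3⟩ := mem_schedules.1 hT
    rw [Set.Finite.mem_toFinset]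
    have h4 : ∀ b : D, (Letter.ofIndex (T b / L)).time L (κ b.1) = T b := fun b =>
      Letter.time_ofIndex (h.lt _ b.2) (h2 b)
    refine ⟨(isQSST_iff h).2 fun p q hpq => ?_, fun b => ?_⟩
    · rw [h4, h4]
      exact h3 p q hpq
    · rw [← Letter.time_lt_iff (h.lt _ b.2), h4]
      exact h1 b
  · intro t _
    ext b : 1
    rw [Letter.time_div (h.lt _ b.2), Letter.ofIndex_index]
  · intro T hT
    ext b
    exact Letter.time_ofIndex (h.lt _ b.2) ((mem_schedules.1 hT).2.1 b)
  · intro t _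
    rw [term, one_div, ← Finset.prod_inv_distrib]
    refine Finset.prod_congr rfl fun b _ => ?_
    rw [timeWeight_time (h.lt _ b.2), hs b.1 b.2, one_div]

end

/-! ### From partitions and their diagrams to the truncated identity -/

/-- The sequence of the parts of a partition, continued by zeros. -/
def extendZero {r : ℕ} (lam : Fin r → ℕ) (i : ℕ) : ℕ := if h : i < r then lam ⟨i, h⟩ else 0

theorem extendZero_val {r : ℕ} (lam : Fin r → ℕ) (i : Fin r) : extendZero lam i = lam i :=
  dif_pos i.2

theorem extendZero_of_le {r : ℕ} (lam : Fin r → ℕ) {i : ℕ} (h : r ≤ i) : extendZero lam i = 0 :=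
  dif_neg h.not_gt

theorem extendZero_lt {r : ℕ} {lam : Fin r → ℕ} (hlam : StrictAnti lam) {i j : ℕ} (hij : i < j)
    (hj : j < r) : extendZero lam j < extendZero lam i := by
  unfold extendZero
  rw [dif_pos hj, dif_pos (hij.trans hj)]
  exact hlam hij

theorem isStrictPartition_extendZero {r : ℕ} {lam : Fin r → ℕ} (hlam : StrictAnti lam) :
    IsStrictPartition r (extendZero lam) := by
  refine ⟨fun i => ?_, fun i => extendZero_of_le lam⟩
  rcases lt_or_ge (i + 1) r with h | h
  · exact Or.inr (extendZero_lt hlam (Nat.lt_succ_self i) h)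
  · exact Or.inl (extendZero_of_le lam h)

theorem mem_shiftedDiagram_extendZero {r : ℕ} {lam : Fin r → ℕ} {b : ℕ × ℕ} :
    b ∈ shiftedDiagram lam ↔ b.1 ≤ b.2 ∧ b.2 < b.1 + extendZero lam b.1 := by
  rw [mem_shiftedDiagram]
  constructor
  · rintro ⟨i, h1, h2, h3⟩
    rw [h1, extendZero_val, ← h1]
    exact ⟨h2, h3⟩
  · rintro ⟨h1, h2⟩
    have h3 : b.1 < r := by
      by_contra h
      rw [extendZero_of_le lam (not_lt.1 h)] at h2
      omega
    refine ⟨⟨b.1, h3⟩, rfl, h1, ?_⟩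
    rwa [← extendZero_val lam ⟨b.1, h3⟩]

theorem skewShiftedDiagram_eq {r m : ℕ} (lam : Fin r → ℕ) (mu : Fin m → ℕ) :
    skewShiftedDiagram lam mu = skewRegion r (extendZero lam) (extendZero mu) := by
  ext b
  rw [skewShiftedDiagram, Finset.mem_sdiff, mem_shiftedDiagram_extendZero,
    mem_shiftedDiagram_extendZero, mem_skewRegion]
  have : r ≤ b.1 → extendZero lam b.1 = 0 := extendZero_of_le lam
  omega

theorem shiftedDiagram_pair (a b : ℕ) :
    shiftedDiagram ![a, b] = skewRegion 2 (pairShape a b) fun _ => 0 := by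
  ext p
  rw [mem_shiftedDiagram, mem_skewRegion]
  simp only [Fin.exists_fin_two, Fin.val_zero, Fin.val_one, Matrix.cons_val_zero,
    Matrix.cons_val_one, Matrix.cons_val_fin_one, pairShape]
  split_ifs <;> omega

theorem isContent_skewRegion {r L : ℕ} {lam mu : ℕ → ℕ} (h : ∀ i, lam i ≤ L) :
    IsContent L (skewRegion r lam mu) fun b => b.2 - b.1 := by
  constructor
  · intro b hb
    have h1 := h b.1
    obtain ⟨_, h2, h3⟩ := mem_skewRegion.1 hb
    omega
  · intro p hp q hq h1 h2
    obtain ⟨_, h3, h4⟩ := mem_skewRegion.1 hp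
    obtain ⟨_, h5, h6⟩ := mem_skewRegion.1 hq
    omega
  · intro p hp q hq h1 h2
    obtain ⟨_, h3, h4⟩ := mem_skewRegion.1 hp
    obtain ⟨_, h5, h6⟩ := mem_skewRegion.1 hq
    omega

/-- The skew row `(k + l)/(k)` is represented by an unskewed row of length `l`, whose labels are
shifted by `k` to recover the original contents. -/
theorem isContent_single {l L k : ℕ} (h : k + l ≤ L) :
    IsContent L (shiftedDiagram ![l]) fun b => k + b.2 := by
  constructor
  · intro b hb
    have := mem_shiftedDiagram_single.1 hb
    omega
  · intro p _ q _ _ h2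
    omega
  · intro p hp q hq _ h2
    have h3 := mem_shiftedDiagram_single.1 hp
    have h4 := mem_shiftedDiagram_single.1 hq
    omega

theorem extendZero_le_of_subset {r m : ℕ} {lam : Fin r → ℕ} {mu : Fin m → ℕ}
    (hsub : shiftedDiagram mu ⊆ shiftedDiagram lam) (i : ℕ) :
    extendZero mu i ≤ extendZero lam i := by
  by_contra h
  have h1 := mem_shiftedDiagram_extendZero.1 (hsub (mem_shiftedDiagram_extendZero.2
    (show (i, i + extendZero lam i).1 ≤ (i, i + extendZero lam i).2 ∧ _ from
      ⟨by dsimp only; omega, by dsimp only; omega⟩)))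
  dsimp only at h1
  omega

/-- The pfaffian formula for the truncated functions. -/
theorem zetaQUpTo_eq_pfaffian {r m n : ℕ} (h : r + m = 2 * n)
    (lam : Fin r → ℕ) (mu : Fin m → ℕ) (hlam : StrictAnti lam) (hmu : StrictAnti mu)
    (hsub : shiftedDiagram mu ⊆ shiftedDiagram lam)
    (s : ℕ × ℕ → ℂ) (hs : DiagonalConstant (shiftedDiagram lam) s) (N : ℕ) :
    zetaQUpTo N (skewShiftedDiagram lam mu) s =
      pfaffian (blockMatrix (zetaQUpTo N) h lam mu s) := by
  set L := extendZero lam 0 with hL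
  have hle : ∀ i, extendZero lam i ≤ L := by
    intro i
    rcases Nat.eq_zero_or_pos i with rfl | hi
    · exact le_rfl
    · have := (isStrictPartition_extendZero hlam).eq_zero_or_lt hi
      omega
  have hle' : ∀ i : Fin r, lam i ≤ L := fun i => by rw [← extendZero_val lam i]; exact hle i
  -- Row `0` is the longest and meets every diagonal of the diagram, so it serves as the exponent as
  -- a function of the content.
  have hz : ∀ i k : ℕ, k < extendZero lam i → s (i, i + k) = s (0, k) := by
    intro i k hk
    have := hle i
    refine hs _ (mem_shiftedDiagram_extendZero.2 ⟨by dsimp only; omega, by dsimp only; omega⟩) _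
      (mem_shiftedDiagram_extendZero.2 ⟨by dsimp only; omega, by dsimp only; omega⟩) ?_
    dsimp only
    push_cast
    ring
  have h1 : zetaQUpTo N (skewShiftedDiagram lam mu) s =
      skewSum (timeContent L) (timeWeight L fun k => s (0, k)) r (extendZero mu) (2 * N * L)
        (extendZero lam) := by
    rw [skewSum, if_pos (extendZero_le_of_subset hsub), skewShiftedDiagram_eq]
    refine zetaQUpTo_eq_scheduleSum (isContent_skewRegion hle) ?_ N
    rintro ⟨i, j⟩ hb
    obtain ⟨_, h2, h3⟩ := mem_skewRegion.1 hb
    dsimp only at h2 h3 ⊢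
    rw [← hz i (j - i) (by omega)]
    congr 2
    omega
  have hm : 2 * n - r = m := by omega
  rw [h1, skewSum_eq_pfaffian (n := n) (by omega)
    (by rw [hm]; exact isStrictPartition_extendZero hmu)
    (by rw [hm]; exact fun i j => extendZero_lt hmu) _ (isStrictPartition_extendZero hlam)]
  refine pfaffian_congr fun u v huv => ?_
  have huv' : (u : ℕ) < v := huv
  obtain ⟨u, rfl⟩ := (finSumFinEquiv.trans (finCongr h)).surjective u
  obtain ⟨v, rfl⟩ := (finSumFinEquiv.trans (finCongr h)).surjective v
  rw [blockMatrix, Matrix.reindex_apply, Matrix.submatrix_apply, Equiv.symm_apply_apply,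
    Equiv.symm_apply_apply]
  rcases u with i | k
  · have hi : ((finSumFinEquiv.trans (finCongr h) (Sum.inl i) : Fin (2 * n)) : ℕ) = i := by simp
    rw [hi] at huv'
    rcases v with j | k
    · have hj : ((finSumFinEquiv.trans (finCongr h) (Sum.inl j) : Fin (2 * n)) : ℕ) = j := by simp
      rw [hj] at huv'
      unfold skewMatrix
      rw [hi, hj, if_pos i.2, if_pos j.2, Matrix.fromBlocks_apply₁₁, matrixM,
        if_pos (show i < j from huv'),
        extendZero_val, extendZero_val, shiftedDiagram_pair, pairSum, skewSum,
        if_pos (fun _ => Nat.zero_le _)]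
      symm
      refine zetaQUpTo_eq_scheduleSum (isContent_skewRegion ?_) ?_ N
      · intro a
        have h2 := hle' i
        have h3 := hle' j
        simp only [pairShape]
        split_ifs <;> omega
      · rintro ⟨a, b⟩ hb
        obtain ⟨h2, h3, h4⟩ := mem_skewRegion.1 hb
        unfold twoRowFilling
        dsimp only at h2 h3 h4 ⊢
        split_ifs with h5
        · subst h5
          rw [Nat.sub_zero]
          refine hz _ _ ?_
          rw [extendZero_val]
          simpa [pairShape] using h4
        · have h6 : a = 1 := by omega
          subst h6
          refine hz _ _ ?_
          rw [extendZero_val]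
          simp [pairShape] at h4
          omega
    · have hk : ((finSumFinEquiv.trans (finCongr h) (Sum.inr k) : Fin (2 * n)) : ℕ) = r + k := by
        simp
      unfold skewMatrix
      have hrev : 2 * n - 1 - (r + (k : ℕ)) = (k.rev : ℕ) := by
        rw [Fin.val_rev]
        omega
      rw [hi, hk, if_pos i.2, if_neg (by omega), Matrix.fromBlocks_apply₁₂, matrixH, hrev,
        extendZero_val, extendZero_val, rowSum]
      split_ifs with h2
      · symm
        have h3 := hle' i
        refine zetaQUpTo_eq_scheduleSum (isContent_single (by omega)) ?_ N
        rintro ⟨a, b⟩ hb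
        have h4 := mem_shiftedDiagram_single.1 hb
        unfold oneRowFilling
        dsimp only at h4 ⊢
        rw [add_assoc]
        refine hz _ _ ?_
        rw [extendZero_val]
        omega
      · rfl
  · have hk : ((finSumFinEquiv.trans (finCongr h) (Sum.inr k) : Fin (2 * n)) : ℕ) = r + k := by
      simp
    unfold skewMatrix
    rw [hk, if_neg (by omega)]
    rcases v with j | j
    · rw [Matrix.fromBlocks_apply₂₁]; rfl
    · rw [Matrix.fromBlocks_apply₂₂]; rfl

end SchurQ

/-! ### Convergence -/

namespace SchurQ

open Filter Topology

section
variable {D : Finset (ℕ × ℕ)} {s : ℕ × ℕ → ℂ}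

theorem norm_term (t : D → Letter) :
    ‖term D s t‖ = (∏ b : D, ((t b).abs : ℝ) ^ (s b.1).re)⁻¹ := by
  rw [term, one_div, norm_inv, norm_prod]
  congr 1
  exact Finset.prod_congr rfl fun b _ => Complex.norm_natCast_cpow_of_pos (t b).abs_pos _

/-- The absolute value of a term depends only on the real parts of the exponents, so absolute
convergence can be studied through the same functions at real arguments. -/
theorem term_re (t : D → Letter) :
    term D (fun b => ((s b).re : ℂ)) t = (‖term D s t‖ : ℂ) := by
  rw [norm_term, term, one_div]
  push_cast
  congr 1
  refine Finset.prod_congr rfl fun b _ => ?_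
  rw [Complex.ofReal_cpow (Nat.cast_nonneg _), Complex.ofReal_natCast]

theorem Converges.re (h : Converges D s) : Converges D fun b => ((s b).re : ℂ) := by
  unfold Converges at h ⊢
  simp only [term_re]
  exact_mod_cast h.norm

open Classical in
/-- The elements of `QSSTUpTo N D`, as elements of `QSST D`. -/
noncomputable def finsetQSSTUpTo (N : ℕ) (D : Finset (ℕ × ℕ)) : Finset (QSST D) :=
  (QSSTUpTo_finite N D).toFinset.subtype (· ∈ QSST D)

theorem mem_finsetQSSTUpTo {N : ℕ} {t : QSST D} :
    t ∈ finsetQSSTUpTo N D ↔ ∀ b, (t.1 b).abs ≤ N := by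
  classical
  rw [finsetQSSTUpTo, Finset.mem_subtype, Set.Finite.mem_toFinset]
  exact ⟨fun h => h.2, fun h => ⟨t.2, h⟩⟩

theorem tendsto_finsetQSSTUpTo (D : Finset (ℕ × ℕ)) :
    Tendsto (fun N => finsetQSSTUpTo N D) atTop atTop := by
  refine tendsto_atTop_finset_of_monotone ?_ ?_
  · intro M N hMN t ht
    rw [mem_finsetQSSTUpTo] at ht ⊢
    exact fun b => (ht b).trans hMN
  · intro t
    refine ⟨∑ b, (t.1 b).abs, mem_finsetQSSTUpTo.2 fun b => ?_⟩
    exact Finset.single_le_sum (f := fun b => (t.1 b).abs) (fun _ _ => Nat.zero_le _)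
      (Finset.mem_univ b)

theorem zetaQUpTo_eq_sum (N : ℕ) :
    zetaQUpTo N D s = ∑ t ∈ finsetQSSTUpTo N D, term D s t.1 := by
  classical
  rw [finsetQSSTUpTo, Finset.sum_subtype_of_mem]
  · rfl
  · intro t ht
    rw [Set.Finite.mem_toFinset] at ht
    exact ht.1

theorem Converges.tendsto_zetaQUpTo (h : Converges D s) :
    Tendsto (fun N => zetaQUpTo N D s) atTop (𝓝 (zetaQ D s)) := by
  simp only [zetaQUpTo_eq_sum]
  exact h.hasSum.comp (tendsto_finsetQSSTUpTo D)

/-- At the real parts of the exponents the truncations are sums of absolute values. They are bounded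
if they converge, and every finite set of tableaux lies in some truncation. -/
theorem converges_of_tendsto_re {a : ℂ}
    (h : Tendsto (fun N => zetaQUpTo N D fun b => ((s b).re : ℂ)) atTop (𝓝 a)) :
    Converges D s := by
  have h1 : Tendsto (fun N => ∑ t ∈ finsetQSSTUpTo N D, ‖term D s t.1‖) atTop (𝓝 a.re) := by
    have h2 := (Complex.continuous_re.tendsto a).comp h
    refine h2.congr fun N => ?_
    rw [Function.comp_apply, zetaQUpTo_eq_sum]
    simp only [term_re]
    rw [← Complex.ofReal_sum, Complex.ofReal_re]
  obtain ⟨K, hK⟩ := h1.bddAbove_range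
  refine Summable.of_norm ?_
  refine summable_of_sum_le (c := K) (fun _ => norm_nonneg _) fun u => ?_
  obtain ⟨N, hN⟩ := ((tendsto_finsetQSSTUpTo D).eventually_ge_atTop u).exists
  exact (Finset.sum_le_sum_of_subset_of_nonneg hN fun _ _ _ => norm_nonneg _).trans
    (hK ⟨N, rfl⟩)

end

/-! ### Passage to the limit in the pfaffian -/

theorem tendsto_pfaffian {n : ℕ} {A : ℕ → Matrix (Fin (2 * n)) (Fin (2 * n)) ℂ}
    {B : Matrix (Fin (2 * n)) (Fin (2 * n)) ℂ}
    (h : ∀ u v, Tendsto (fun N => A N u v) atTop (𝓝 (B u v))) :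
    Tendsto (fun N => pfaffian (A N)) atTop (𝓝 (pfaffian B)) :=
  tendsto_finsetSum _ fun _ _ => (tendsto_finsetProd _ fun _ _ => h _ _).const_mul _

theorem EntriesConverge.tendsto_pfaffian {r m n : ℕ} (h : r + m = 2 * n) {lam : Fin r → ℕ}
    {mu : Fin m → ℕ} {s : ℕ × ℕ → ℂ} (hs : EntriesConverge lam mu s) :
    Tendsto (fun N => pfaffian (blockMatrix (zetaQUpTo N) h lam mu s)) atTop
      (𝓝 (pfaffian (blockMatrix zetaQ h lam mu s))) := by
  refine SchurQ.tendsto_pfaffian fun u v => ?_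
  simp only [blockMatrix, Matrix.reindex_apply, Matrix.submatrix_apply]
  rcases (finSumFinEquiv.trans (finCongr h)).symm u with i | i <;>
    rcases (finSumFinEquiv.trans (finCongr h)).symm v with j | j
  · simp only [Matrix.fromBlocks_apply₁₁, matrixM]
    split_ifs with hij
    · exact (hs.1 i j hij).tendsto_zetaQUpTo
    · exact tendsto_const_nhds
  · simp only [Matrix.fromBlocks_apply₁₂, matrixH]
    split_ifs with hij
    · exact (hs.2 i _ hij).tendsto_zetaQUpTo
    · exact tendsto_const_nhds
  · simp only [Matrix.fromBlocks_apply₂₁]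
    exact tendsto_const_nhds
  · simp only [Matrix.fromBlocks_apply₂₂]
    exact tendsto_const_nhds

theorem EntriesConverge.re {r m : ℕ} {lam : Fin r → ℕ} {mu : Fin m → ℕ} {s : ℕ × ℕ → ℂ}
    (hs : EntriesConverge lam mu s) : EntriesConverge lam mu fun b => ((s b).re : ℂ) := by
  refine ⟨fun i j hij => ?_, fun i k hk => (hs.2 i k hk).re⟩
  have h1 : twoRowFilling (fun b => ((s b).re : ℂ)) i j =
      fun b => ((twoRowFilling s i j b).re : ℂ) := by
    ext b
    unfold twoRowFilling
    split_ifs <;> rfl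
  rw [h1]
  exact (hs.1 i j hij).re

/-! ### An explicit domain of convergence -/

theorem Letter.abs_le_abs {l l' : Letter} (h : l ≤ l') : l.abs ≤ l'.abs := by
  have := Letter.index_le_index.2 h
  rw [Letter.abs_eq, Letter.abs_eq]
  omega

theorem summable_letter_rpow {p : ℝ} (hp : 1 < p) :
    Summable fun l : Letter => (l.abs : ℝ) ^ (-p) := by
  have h1 : Summable fun k : ℕ+ => ((k : ℕ) : ℝ) ^ (-p) :=
    (Real.summable_nat_rpow.2 (by linarith)).comp_injective PNat.coe_injective
  have h2 : Summable fun y : ℕ+ × Bool => ((y.1 : ℕ) : ℝ) ^ (-p) := by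
    refine (summable_prod_of_nonneg fun y => Real.rpow_nonneg (Nat.cast_nonneg _) _).2 ⟨?_, ?_⟩
    · intro k
      exact Summable.of_finite
    · simp only [tsum_fintype, Finset.sum_const]
      exact h1.const_smul _
  exact h2

/-- A finite set of functions lies in the product of its coordinate projections, over which the sum
factors. -/
theorem summable_prod_comp {ι κ : Type*} [Fintype ι] {g : κ → ℝ} (hg : Summable g)
    (hg0 : ∀ k, 0 ≤ g k) : Summable fun t : ι → κ => ∏ b, g (t b) := by
  classical
  refine summable_of_sum_le (c := ∏ _b : ι, ∑' k, g k)
    (fun t => Finset.prod_nonneg fun b _ => hg0 _) fun u => ?_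
  calc ∑ t ∈ u, ∏ b, g (t b)
      ≤ ∑ t ∈ Fintype.piFinset fun b => u.image fun t => t b, ∏ b, g (t b) := by
        refine Finset.sum_le_sum_of_subset_of_nonneg ?_ fun _ _ _ =>
          Finset.prod_nonneg fun b _ => hg0 _
        intro t ht
        rw [Fintype.mem_piFinset]
        exact fun b => Finset.mem_image_of_mem _ ht
    _ = ∏ b, ∑ k ∈ u.image fun t => t b, g k := (Finset.prod_univ_sum _ _).symm
    _ ≤ ∏ _b : ι, ∑' k, g k :=
        Finset.prod_le_prod (fun b _ => Finset.sum_nonneg fun _ _ => hg0 _)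
          fun b _ => hg.sum_le_tsum _ fun _ _ => hg0 _

/-- A sufficient condition for convergence: all exponents have real part at least `1`, and every
row contains, to the right of each box, an exponent with real part greater than `1`. -/
theorem converges_of_one_le_re {D : Finset (ℕ × ℕ)} {s : ℕ × ℕ → ℂ}
    (h1 : ∀ b ∈ D, 1 ≤ (s b).re)
    (h2 : ∀ b ∈ D, ∃ b' ∈ D, b.1 = b'.1 ∧ b.2 ≤ b'.2 ∧ 1 < (s b').re) : Converges D s := by
  classical
  rcases D.eq_empty_or_nonempty with rfl | hD
  · exact Summable.of_finite
  have : Nonempty D := hD.to_subtype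
  choose! e he1 he2 he3 he4 using h2
  -- Each box `b` borrows a small exponent from `f b`, a box weakly to its right whose exponent
  -- exceeds `1`. The entry there is at least as large, so moving exponent from `f b` to `b` can
  -- only increase the term.
  let f : D → D := fun b => ⟨e b.1, he1 b.1 b.2⟩
  obtain ⟨b₀, hb₀⟩ := Finite.exists_min fun b : D => (s (e b.1)).re
  set δ := (s (e b₀.1)).re - 1 with hδ
  have hδ0 : 0 < δ := by have := he4 b₀.1 b₀.2; linarith
  have hcard : (0 : ℝ) < Fintype.card D := by exact_mod_cast Fintype.card_pos
  -- At most `card D` boxes borrow from the same box, which therefore gives away at most `δ`, the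
  -- smallest available excess over `1`.
  set ε := δ / Fintype.card D with hε
  have hε0 : 0 < ε := div_pos hδ0 hcard
  have hsum : Summable fun t : QSST D => ∏ b : D, ((t.1 b).abs : ℝ) ^ (-(1 + ε)) :=
    (summable_prod_comp (summable_letter_rpow (p := 1 + ε) (by linarith))
      fun _ => Real.rpow_nonneg (Nat.cast_nonneg _) _).comp_injective Subtype.val_injective
  refine Summable.of_norm_bounded hsum fun t => ?_
  have hone : ∀ b, (1 : ℝ) ≤ (t.1 b).abs := fun b => by exact_mod_cast (t.1 b).abs_pos
  have hpos : ∀ b, (0 : ℝ) < (t.1 b).abs := fun b => lt_of_lt_of_le one_pos (hone b)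
  have hmono : ∀ b, ((t.1 b).abs : ℝ) ≤ (t.1 (f b)).abs := fun b => by
    exact_mod_cast Letter.abs_le_abs (t.2.row_weak b (f b) (he2 b.1 b.2) (he3 b.1 b.2))
  have hfib : ∏ b : D, ((t.1 (f b)).abs : ℝ) ^ ε =
      ∏ c : D, ((t.1 c).abs : ℝ) ^ (ε * (Finset.univ.filter fun b => f b = c).card) := by
    rw [← Finset.prod_fiberwise Finset.univ f]
    refine Finset.prod_congr rfl fun c _ => ?_
    rw [Real.rpow_mul (hpos c).le, Real.rpow_natCast, ← Finset.prod_const]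
    refine Finset.prod_congr rfl fun b hb => ?_
    rw [(Finset.mem_filter.1 hb).2]
  have key : ∏ b : D, ((t.1 b).abs : ℝ) ^ (1 + ε) ≤ ∏ b : D, ((t.1 b).abs : ℝ) ^ (s b.1).re := by
    calc ∏ b : D, ((t.1 b).abs : ℝ) ^ (1 + ε)
        = (∏ b : D, ((t.1 b).abs : ℝ)) * ∏ b : D, ((t.1 b).abs : ℝ) ^ ε := by
          rw [← Finset.prod_mul_distrib]
          refine Finset.prod_congr rfl fun b _ => ?_
          rw [Real.rpow_add (hpos b), Real.rpow_one]
      _ ≤ (∏ b : D, ((t.1 b).abs : ℝ)) * ∏ b : D, ((t.1 (f b)).abs : ℝ) ^ ε := by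
          refine mul_le_mul_of_nonneg_left ?_ (Finset.prod_nonneg fun b _ => (hpos b).le)
          exact Finset.prod_le_prod (fun b _ => Real.rpow_nonneg (hpos b).le _)
            fun b _ => Real.rpow_le_rpow (hpos b).le (hmono b) hε0.le
      _ = ∏ c : D, ((t.1 c).abs : ℝ) ^
            (1 + ε * (Finset.univ.filter fun b => f b = c).card) := by
          rw [hfib, ← Finset.prod_mul_distrib]
          refine Finset.prod_congr rfl fun c _ => ?_
          rw [Real.rpow_add (hpos c), Real.rpow_one]
      _ ≤ ∏ b : D, ((t.1 b).abs : ℝ) ^ (s b.1).re := by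
          refine Finset.prod_le_prod (fun b _ => Real.rpow_nonneg (hpos b).le _) fun c _ => ?_
          refine Real.rpow_le_rpow_of_exponent_le (hone c) ?_
          rcases (Finset.univ.filter fun b => f b = c).eq_empty_or_nonempty with h0 | ⟨b, hb⟩
          · rw [h0, Finset.card_empty, Nat.cast_zero, mul_zero, add_zero]
            exact h1 c.1 c.2
          · have h3 : ((Finset.univ.filter fun b => f b = c).card : ℝ) ≤ Fintype.card D := by
              exact_mod_cast Finset.card_le_univ _
            have h4 : ε * (Finset.univ.filter fun b => f b = c).card ≤ δ := by
              calc ε * (Finset.univ.filter fun b => f b = c).card ≤ ε * Fintype.card D :=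
                    mul_le_mul_of_nonneg_left h3 hε0.le
                _ = δ := div_mul_cancel₀ _ hcard.ne'
            have h5 := hb₀ b
            have h6 : e b.1 = c.1 := congrArg Subtype.val (Finset.mem_filter.1 hb).2
            rw [h6] at h5
            linarith
  rw [norm_term]
  calc (∏ b : D, ((t.1 b).abs : ℝ) ^ (s b.1).re)⁻¹
      ≤ (∏ b : D, ((t.1 b).abs : ℝ) ^ (1 + ε))⁻¹ :=
        inv_anti₀ (Finset.prod_pos fun b _ => Real.rpow_pos_of_pos (hpos b) _) key
    _ = ∏ b : D, ((t.1 b).abs : ℝ) ^ (-(1 + ε)) := by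
        rw [← Finset.prod_inv_distrib]
        exact Finset.prod_congr rfl fun b _ => (Real.rpow_neg (hpos b).le _).symm

theorem entriesConverge_of_one_le_re {r m : ℕ} {lam : Fin r → ℕ} {mu : Fin m → ℕ}
    {s : ℕ × ℕ → ℂ} (h1 : ∀ b ∈ shiftedDiagram lam, 1 ≤ (s b).re)
    (h2 : ∀ i : Fin r, 0 < lam i → 1 < (s ((i : ℕ), i + lam i - 1)).re) :
    EntriesConverge lam mu s := by
  have h1' : ∀ (i : Fin r) (k : ℕ), k < lam i → 1 ≤ (s (i, i + k)).re := fun i k hk =>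
    h1 _ ((mem_shiftedDiagram lam _).2 ⟨i, rfl, by dsimp only; omega, by dsimp only; omega⟩)
  have h2' : ∀ (i : Fin r) (k : ℕ), k < lam i → 1 < (s (i, i + (lam i - 1))).re := by
    intro i k hk
    have := h2 i (by omega)
    rwa [Nat.add_sub_assoc (by omega)] at this
  constructor
  · intro i j _
    have hmem : ∀ b, b ∈ shiftedDiagram ![lam i, lam j] ↔
        (b.1 = 0 ∧ b.2 < lam i) ∨ (b.1 = 1 ∧ 1 ≤ b.2 ∧ b.2 < 1 + lam j) := by
      intro b
      rw [mem_shiftedDiagram]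
      simp only [Fin.exists_fin_two, Fin.val_zero, Fin.val_one, Matrix.cons_val_zero,
        Matrix.cons_val_one, Matrix.cons_val_fin_one]
      omega
    refine converges_of_one_le_re ?_ ?_
    · rintro ⟨a, b⟩ hb
      rcases (hmem _).1 hb with ⟨rfl, h4⟩ | ⟨rfl, h4, h5⟩
      · exact h1' i b h4
      · exact h1' j (b - 1) (by dsimp only at h4 h5; omega)
    · rintro ⟨a, b⟩ hb
      rcases (hmem _).1 hb with ⟨rfl, h4⟩ | ⟨rfl, h4, h5⟩
      · dsimp only at h4
        exact ⟨(0, lam i - 1), (hmem _).2 (Or.inl ⟨rfl, by dsimp only; omega⟩), rfl,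
          by dsimp only; omega, h2' i b h4⟩
      · dsimp only at h4 h5
        refine ⟨(1, lam j), (hmem _).2 (Or.inr ⟨rfl, by dsimp only; omega, by dsimp only; omega⟩),
          rfl, by dsimp only; omega, h2' j (b - 1) (by omega)⟩
  · intro i k hk
    refine converges_of_one_le_re ?_ ?_
    · rintro ⟨a, b⟩ hb
      obtain ⟨_, h4⟩ := mem_shiftedDiagram_single.1 hb
      unfold oneRowFilling
      dsimp only at h4 ⊢
      rw [add_assoc]
      exact h1' i _ (by omega)
    · rintro ⟨a, b⟩ hb
      obtain ⟨h3, h4⟩ := mem_shiftedDiagram_single.1 hb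
      dsimp only at h3 h4
      refine ⟨(0, lam i - mu k - 1), mem_shiftedDiagram_single.2 ⟨rfl, by dsimp only; omega⟩, h3,
        by dsimp only; omega, ?_⟩
      have h5 := h2' i (mu k + b) (by omega)
      unfold oneRowFilling
      dsimp only
      rwa [show (i : ℕ) + mu k + (lam i - mu k - 1) = i + (lam i - 1) by omega]

end SchurQ

theorem mainTheorem2 {r m n : ℕ} (h : r + m = 2 * n)
    (lam : Fin r → ℕ) (mu : Fin m → ℕ) (hlam : StrictAnti lam) (hmu : StrictAnti mu)
    (hsub : SchurQ.shiftedDiagram mu ⊆ SchurQ.shiftedDiagram lam)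
    (s : ℕ × ℕ → ℂ) (hs : SchurQ.DiagonalConstant (SchurQ.shiftedDiagram lam) s) :
    -- the identity for the series, wherever the series in the matrix converge absolutely
    (SchurQ.EntriesConverge lam mu s →
      SchurQ.Converges (SchurQ.skewShiftedDiagram lam mu) s ∧
      SchurQ.zetaQ (SchurQ.skewShiftedDiagram lam mu) s =
        SchurQ.pfaffian (SchurQ.blockMatrix SchurQ.zetaQ h lam mu s)) ∧
    -- an explicit domain where they do
    ((∀ b ∈ SchurQ.shiftedDiagram lam, 1 ≤ (s b).re) →
      (∀ i : Fin r, 0 < lam i → 1 < (s ((i : ℕ), i + lam i - 1)).re) →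
      SchurQ.EntriesConverge lam mu s) ∧
    -- the truncated identity, without any condition of convergence
    (∀ N : ℕ, SchurQ.zetaQUpTo N (SchurQ.skewShiftedDiagram lam mu) s =
      SchurQ.pfaffian (SchurQ.blockMatrix (SchurQ.zetaQUpTo N) h lam mu s)) := by
  refine ⟨fun hc => ?_, SchurQ.entriesConverge_of_one_le_re,
    SchurQ.zetaQUpTo_eq_pfaffian h lam mu hlam hmu hsub s hs⟩
  have hs' : SchurQ.DiagonalConstant (SchurQ.shiftedDiagram lam) fun b => ((s b).re : ℂ) :=
    fun p hp q hq hpq => congrArg (fun w : ℂ => (w.re : ℂ)) (hs p hp q hq hpq)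
  -- The truncated identity at the real parts shows that the sums of absolute values converge; the
  -- identity at `s` itself is needed only afterwards, to identify the limit.
  have hconv : SchurQ.Converges (SchurQ.skewShiftedDiagram lam mu) s := by
    refine SchurQ.converges_of_tendsto_re ((hc.re.tendsto_pfaffian h).congr fun N => ?_)
    exact (SchurQ.zetaQUpTo_eq_pfaffian h lam mu hlam hmu hsub _ hs' N).symm
  refine ⟨hconv, tendsto_nhds_unique hconv.tendsto_zetaQUpTo
    ((hc.tendsto_pfaffian h).congr fun N => ?_)⟩
  exact (SchurQ.zetaQUpTo_eq_pfaffian h lam mu hlam hmu hsub s hs N).symm
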